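/- **Setting.** Let $(T,h)$ and $(M,\varphi)$ be smooth semi-Riemannian manifolds, $\dim T=p$, $\dim M=n$, with local coordinates $t^\alpha$ and $x^i$, and let $(t^\alpha,x^i,x^i_\alpha)$ be the induced coordinates on the jet space $J^1(T,M)$. Let $\sigma:J^1(T,M)\to\mathbb R$ be smooth and $g_{ij}=e^{2\sigma}\varphi_{ij}$. Repeated indices are summed. Let $H^\gamma_{\alpha\beta}$, $\gamma^i_{jk}$ be the Christoffel symbols of $h$, $\varphi$, and $$H^\alpha_{\eta\beta\gamma}=\frac{\partial H^\alpha_{\eta\beta}}{\partial t^\gamma}-\frac{\partial H^\alpha_{\eta\gamma}}{\partial t^\beta}+H^\mu_{\eta\beta}H^\alpha_{\mu\gamma}-H^\mu_{\eta\gamma}H^\alpha_{\mu\beta},\qquad r^l_{ijk}=\frac{\partial \gamma^l_{ij}}{\partial x^k}-\frac{\partial \gamma^l_{ik}}{\partial x^j}+\gamma^m_{ij}\gamma^l_{mk}-\gamma^m_{ik}\gamma^l_{mj}$$ their curvature tensors. Fix the nonlinear connection $M^{(i)}_{(\alpha)\beta}=-H^\mu_{\alpha\beta}x^i_\mu$,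 $N^{(i)}_{(\alpha)j}=\gamma^i_{jm}x^m_\alpha$, with adapted frame $$(X_A)=\Big(\frac{\delta}{\delta t^\alpha}=\frac{\partial}{\partial t^\alpha}-M^{(j)}_{(\beta)\alpha}\frac{\partial}{\partial x^j_\beta},\quad \frac{\delta}{\delta x^i}=\frac{\partial}{\partial x^i}-N^{(j)}_{(\beta)i}\frac{\partial}{\partial x^j_\beta},\quad \frac{\partial}{\partial x^i_\alpha}\Big).$$ An $h$-normal $\Gamma$-linear connection $(H^\gamma_{\alpha\beta},G^k_{j\gamma},L^k_{ij},C^{i(\gamma)}_{j(k)})$ is the linear connection $\nabla$ on $J^1(T,M)$ given by - $\nabla_{\delta/\delta t^\beta}\frac{\delta}{\delta t^\alpha}=H^\gamma_{\alpha\beta}\frac{\delta}{\delta t^\gamma}$, $\ \nabla_{\delta/\delta x^j}\frac{\delta}{\delta t^\alpha}=\nabla_{\partial/\partial x^j_\gamma}\frac{\delta}{\delta t^\alpha}=0$; - $\nabla_{\delta/\delta t^\gamma}\frac{\delta}{\delta x^i}=G^k_{i\gamma}\frac{\delta}{\delta x^k}$, $\ \nabla_{\delta/\delta x^j}\frac{\delta}{\delta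 x^i}=L^k_{ij}\frac{\delta}{\delta x^k}$, $\ \nabla_{\partial/\partial x^j_\gamma}\frac{\delta}{\delta x^i}=C^{k(\gamma)}_{i(j)}\frac{\delta}{\delta x^k}$; - $\nabla_{\delta/\delta t^\gamma}\frac{\partial}{\partial x^i_\alpha}=(\delta^\alpha_\eta G^k_{i\gamma}-\delta^k_iH^\alpha_{\eta\gamma})\frac{\partial}{\partial x^k_\eta}$, $\ \nabla_{\delta/\delta x^j}\frac{\partial}{\partial x^i_\alpha}=L^k_{ij}\frac{\partial}{\partial x^k_\alpha}$, $\ \nabla_{\partial/\partial x^j_\gamma}\frac{\partial}{\partial x^i_\alpha}=C^{k(\gamma)}_{i(j)}\frac{\partial}{\partial x^k_\alpha}$. The *Cartan canonical connection* is the $h$-normal $\Gamma$-linear connection with $$\frac{\delta g_{ij}}{\delta x^k}=g_{mj}L^m_{ik}+g_{im}L^m_{jk},\quad \frac{\partial g_{ij}}{\partial x^k_\gamma}=g_{mj}C^{m(\gamma)}_{i(k)}+g_{im}C^{m(\gamma)}_{j(k)},\quad G^k_{j\gamma}=\tfrac12 g^{km}\frac{\delta g_{mj}}{\delta t^\gamma},\quad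 L^k_{ij}=L^k_{ji},\quad C^{i(\gamma)}_{j(k)}=C^{i(\gamma)}_{k(j)}.$$ Put $\sigma_\gamma=\frac{\delta\sigma}{\delta t^\gamma}$, $\sigma_k=\frac{\delta\sigma}{\delta x^k}$, $\sigma^{(\gamma)}_{(k)}=\frac{\partial\sigma}{\partial x^k_\gamma}$, $\sigma^k=\varphi^{km}\sigma_m$, $\sigma^{k\gamma}=\varphi^{km}\sigma^{(\gamma)}_{(m)}$, and $$\Lambda^k_{ij}=\sigma_i\delta^k_j+\sigma_j\delta^k_i-\varphi_{ij}\sigma^k,\qquad C^{i(\gamma)}_{j(k)}=\sigma^{(\gamma)}_{(k)}\delta^i_j+\sigma^{(\gamma)}_{(j)}\delta^i_k-\varphi_{jk}\sigma^{i\gamma}.$$ Let ${}_{//\beta}$, ${}_{\Vert k}$, $\Vert^{(\gamma)}_{(k)}$ be the covariant derivatives of the Berwald connection $(H^\gamma_{\alpha\beta},0,\gamma^i_{jk},0)$; thus $\sigma_{m//\beta}=\frac{\delta\sigma_m}{\delta t^\beta}$, $\ \Vert^{(\gamma)}_{(k)}=\frac{\partial}{\partial x^k_\gamma}$ on components, $$\Lambda^l_{ij\Vert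 k}=\frac{\delta\Lambda^l_{ij}}{\delta x^k}+\Lambda^m_{ij}\gamma^l_{mk}-\Lambda^l_{mj}\gamma^m_{ik}-\Lambda^l_{im}\gamma^m_{jk},\qquad C^{l(\gamma)}_{i(k)\Vert j}=\frac{\delta C^{l(\gamma)}_{i(k)}}{\delta x^j}+C^{m(\gamma)}_{i(k)}\gamma^l_{mj}-C^{l(\gamma)}_{m(k)}\gamma^m_{ij}-C^{l(\gamma)}_{i(m)}\gamma^m_{kj}.$$ Write ${\bf T}(X_C,X_B)=T^D_{BC}X_D$ for the torsion and ${\bf R}(X_C,X_B)X_A=R^D_{ABC}X_D$ for the curvature ${\bf R}(X,Y)Z=\nabla_X\nabla_YZ-\nabla_Y\nabla_XZ-\nabla_{[X,Y]}Z$ of the Cartan canonical connection, and let $R^{(m)}_{(\mu)\beta\gamma}$, $R^{(m)}_{(\mu)jk}$ be the components of ${\bf T}\big(\frac{\delta}{\delta t^\gamma},\frac{\delta}{\delta t^\beta}\big)$, ${\bf T}\big(\frac{\delta}{\delta x^k},\frac{\delta}{\delta x^j}\big)$ along $\frac{\partial}{\partial x^m_\mu}$. **Theorem.** One has $R^{(m)}_{(\mu)\beta\gamma}=-H^\varepsilon_{\mu\beta\gamma}x^m_\varepsilon$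 and $R^{(m)}_{(\mu)jk}=r^m_{qjk}x^q_\mu$. The curvature ${\bf R}$ is determined by seven local d-tensors, in the following sense. - $R^D_{ABC}=-R^D_{ACB}$, and $R^D_{ABC}=0$ if $A$ and $D$ are not of the same type (temporal, spatial, vertical). - For $A,D$ both temporal the only nonzero components are those with $B,C$ temporal: ${\bf R}\big(\frac{\delta}{\delta t^\gamma},\frac{\delta}{\delta t^\beta}\big)\frac{\delta}{\delta t^\eta}=H^\alpha_{\eta\beta\gamma}\frac{\delta}{\delta t^\alpha}$. - For all $B,C$, the component of ${\bf R}(X_C,X_B)\frac{\partial}{\partial x^i_\alpha}$ along $\frac{\partial}{\partial x^l_\eta}$ is $\delta^\alpha_\eta R^l_{iBC}-\delta^l_iR^\alpha_{\eta BC}$. - The components $R^l_{iBC}$ of ${\bf R}(X_C,X_B)\frac{\delta}{\delta x^i}$ along $\frac{\delta}{\delta x^l}$ are given by the following six formulas, in which $(B,C)$ is $(\beta,\gamma)$, $(\beta,k)$, $(j,k)$, $\big(\beta,{}^{(\gamma)}_{(k)}\big)$, $\big(j,{}^{(\gamma)}_{(k)}\big)$, $\big({}^{(\beta)}_{(j)},{}^{(\gamma)}_{(k)}\big)$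 respectively: $$\begin{aligned} R^l_{i\beta\gamma}&=\big[C^{l(\mu)}_{i(m)}-\delta^l_i\sigma^{(\mu)}_{(m)}\big]R^{(m)}_{(\mu)\beta\gamma},\\ R^l_{i\beta k}&=\big[\varphi_{ik}\varphi^{lm}-\delta^l_k\delta^m_i\big]\sigma_{m//\beta},\\ R^l_{ijk}&=r^l_{ijk}+\Lambda^l_{ij\Vert k}-\Lambda^l_{ik\Vert j}+\Lambda^m_{ij}\Lambda^l_{mk}-\Lambda^m_{ik}\Lambda^l_{mj}+C^{l(\mu)}_{i(m)}R^{(m)}_{(\mu)jk},\\ P^{l\;\;(\gamma)}_{i\beta(k)}&=\frac{\partial\sigma_\beta}{\partial x^k_\gamma}\delta^l_i-\frac{\delta C^{l(\gamma)}_{i(k)}}{\delta t^\beta}-C^{l(\mu)}_{i(k)}H^\gamma_{\mu\beta},\\ P^{l\;(\gamma)}_{ij(k)}&=\Lambda^l_{ij}\Vert^{(\gamma)}_{(k)}-C^{l(\gamma)}_{i(k)\Vert j}-\Lambda^l_{jm}C^{m(\gamma)}_{i(k)}+\Lambda^m_{ij}C^{l(\gamma)}_{m(k)},\\ S^{l(\beta)(\gamma)}_{i(j)(k)}&=C^{l(\beta)}_{i(j)}\Vert^{(\gamma)}_{(k)}-C^{l(\gamma)}_{i(k)}\Vert^{(\beta)}_{(j)}+C^{m(\beta)}_{i(j)}C^{l(\gamma)}_{m(k)}-C^{m(\gamma)}_{i(k)}C^{l(\beta)}_{m(j)}.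 \end{aligned}$$ -/

import Mathlib

open scoped ContDiff

noncomputable section

/-- Adapted coordinates `(t^α, x^i, x^i_α)` of the first order jet space `J¹(T, M)`,
`dim T = p`, `dim M = n`. The coordinate `x^i_α` of `e` is `e.2.2 i α`. -/
abbrev JetCoord (p n : ℕ) : Type :=
  (Fin p → ℝ) × (Fin n → ℝ) × (Fin n → Fin p → ℝ)

/-- Indices of the adapted frame: temporal `α`, spatial `i`, vertical `(i, α)`. -/
inductive JetIdx (p n : ℕ) : Type
  | T (α : Fin p)
  | M (i : Fin n)
  | V (i : Fin n) (α : Fin p)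
  deriving DecidableEq, Fintype

/-- Kronecker symbol. -/
def kron {ι : Type} [DecidableEq ι] (a b : ι) : ℝ := if a = b then 1 else 0

section Metric

variable {m : ℕ}

/-- Components, in a chart with image `U`, of a smooth semi-Riemannian metric. -/
structure IsSemiRiemannianOn (g : (Fin m → ℝ) → Matrix (Fin m) (Fin m) ℝ)
    (U : Set (Fin m → ℝ)) : Prop where
  smooth : ∀ i j, ContDiffOn ℝ ∞ (fun x => g x i j) U
  symm : ∀ x ∈ U, (g x).IsSymm
  nondegenerate : ∀ x ∈ U, IsUnit (g x).det

/-- The partial derivative `∂f/∂x^k`. -/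
def partialDeriv (f : (Fin m → ℝ) → ℝ) (k : Fin m) (x : Fin m → ℝ) : ℝ :=
  fderiv ℝ f x (Pi.single k 1)

/-- The Christoffel symbols `Γ^l_{ij}` of the metric `g`. -/
def christoffel (g : (Fin m → ℝ) → Matrix (Fin m) (Fin m) ℝ) (l i j : Fin m)
    (x : Fin m → ℝ) : ℝ :=
  (1 / 2) * ∑ r, (g x)⁻¹ l r * (partialDeriv (fun y => g y j r) i x
    + partialDeriv (fun y => g y i r) j x - partialDeriv (fun y => g y i j) r x)

/-- The curvature tensor of the metric `g`:
`r^l_{ijk} = ∂_k Γ^l_{ij} - ∂_j Γ^l_{ik} + Γ^s_{ij} Γ^l_{sk} - Γ^s_{ik} Γ^l_{sj}`. -/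
def metricCurvature (g : (Fin m → ℝ) → Matrix (Fin m) (Fin m) ℝ) (l i j k : Fin m)
    (x : Fin m → ℝ) : ℝ :=
  partialDeriv (christoffel g l i j) k x - partialDeriv (christoffel g l i k) j x
    + ∑ s, christoffel g s i j x * christoffel g l s k x
    - ∑ s, christoffel g s i k x * christoffel g l s j x

end Metric

/-- The space `GRGML^n_p` over a product of charts of `T` and `M`: the metric `h` on the chart
image `U` of `T`, the metric `φ` on the chart image `V` of `M`, and the conformal function `σ`
on the part of `J¹(T, M)` over `U × V`. The functions are total; only their values over `U`, `V`
and `U × V` matter. -/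
structure GRGML (p n : ℕ) where
  U : Set (Fin p → ℝ)
  V : Set (Fin n → ℝ)
  isOpen_U : IsOpen U
  isOpen_V : IsOpen V
  h : (Fin p → ℝ) → Matrix (Fin p) (Fin p) ℝ
  φ : (Fin n → ℝ) → Matrix (Fin n) (Fin n) ℝ
  σ : JetCoord p n → ℝ
  h_metric : IsSemiRiemannianOn h U
  φ_metric : IsSemiRiemannianOn φ V
  σ_smooth : ContDiffOn ℝ ∞ σ {e | e.1 ∈ U ∧ e.2.1 ∈ V}

/-- An `h`-normal `Γ`-linear connection `(H^γ_{αβ}, G^k_{jγ}, L^k_{ij}, C^{i(γ)}_{j(k)})` on the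
jet space, given by its free coefficients (`H` is always the Christoffel symbol of `h`).
Index order: `G k j γ = G^k_{jγ}`, `L k i j = L^k_{ij}`, `C i j k γ = C^{i(γ)}_{j(k)}`. -/
structure HNormalConnection (p n : ℕ) where
  G : Fin n → Fin n → Fin p → JetCoord p n → ℝ
  L : Fin n → Fin n → Fin n → JetCoord p n → ℝ
  C : Fin n → Fin n → Fin n → Fin p → JetCoord p n → ℝ

namespace GRGML

variable {p n : ℕ} (S : GRGML p n)

/-- The coordinate domain in `J¹(T, M)`. -/
def domain : Set (JetCoord p n) := {e | e.1 ∈ S.U ∧ e.2.1 ∈ S.V}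

/-- The spatial metrical d-tensor `g_{ij} = e^{2σ} φ_{ij}`. -/
def g (e : JetCoord p n) : Matrix (Fin n) (Fin n) ℝ :=
  Matrix.of fun i j => Real.exp (2 * S.σ e) * S.φ e.2.1 i j

/-- Temporal components `M^{(i)}_{(α)β} = - H^μ_{αβ} x^i_μ` of the nonlinear connection. -/
def temporalN (i : Fin n) (α β : Fin p) (e : JetCoord p n) : ℝ :=
  - ∑ μ, christoffel S.h μ α β e.1 * e.2.2 i μ

/-- Spatial components `N^{(i)}_{(α)j} = γ^i_{jm} x^m_α` of the nonlinear connection. -/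
def spatialN (i : Fin n) (α : Fin p) (j : Fin n) (e : JetCoord p n) : ℝ :=
  ∑ m, christoffel S.φ i j m e.2.1 * e.2.2 m α

/-- The adapted frame `δ/δt^α`, `δ/δx^i`, `∂/∂x^i_α`. -/
def frame : JetIdx p n → JetCoord p n → JetCoord p n
  | .T α, e => (Pi.single α 1, 0, fun j β => - S.temporalN j β α e)
  | .M i, e => (0, Pi.single i 1, fun j β => - S.spatialN j β i e)
  | .V i α, _ => (0, 0, Pi.single i (Pi.single α 1))

/-- The adapted coframe `dt^α`, `dx^i`, `δx^i_α = dx^i_α + M^{(i)}_{(α)β} dt^β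
+ N^{(i)}_{(α)j} dx^j` at `e`, evaluated on a tangent vector `v`. -/
def coframe : JetIdx p n → JetCoord p n → JetCoord p n → ℝ
  | .T α, _, v => v.1 α
  | .M i, _, v => v.2.1 i
  | .V i α, e, v => v.2.2 i α + ∑ β, S.temporalN i α β e * v.1 β
      + ∑ j, S.spatialN i α j e * v.2.1 j

/-- The derivative `X_A f` of a function along the adapted frame field `X_A`. -/
def D (A : JetIdx p n) (f : JetCoord p n → ℝ) (e : JetCoord p n) : ℝ :=
  fderiv ℝ f e (S.frame A e)

/-- The coefficients in `∇_{X_B} X_A = coeff D A B • X_D` (sum over `D`) of an `h`-normal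
`Γ`-linear connection:
`∇_{δ/δt^β} δ/δt^α = H^γ_{αβ} δ/δt^γ`, `∇_{δ/δx^j} δ/δt^α = ∇_{∂/∂x^j_γ} δ/δt^α = 0`;
`∇_{δ/δt^γ} δ/δx^i = G^k_{iγ} δ/δx^k`, `∇_{δ/δx^j} δ/δx^i = L^k_{ij} δ/δx^k`,
`∇_{∂/∂x^j_γ} δ/δx^i = C^{k(γ)}_{i(j)} δ/δx^k`;
`∇_{δ/δt^γ} ∂/∂x^i_α = (δ^α_η G^k_{iγ} - δ^k_i H^α_{ηγ}) ∂/∂x^k_η`,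
`∇_{δ/δx^j} ∂/∂x^i_α = L^k_{ij} ∂/∂x^k_α`,
`∇_{∂/∂x^j_γ} ∂/∂x^i_α = C^{k(γ)}_{i(j)} ∂/∂x^k_α`. -/
def coeff (Γ : HNormalConnection p n) :
    JetIdx p n → JetIdx p n → JetIdx p n → JetCoord p n → ℝ
  | .T γ, .T α, .T β, e => christoffel S.h γ α β e.1
  | .M k, .M i, .T γ, e => Γ.G k i γ e
  | .M k, .M i, .M j, e => Γ.L k i j e
  | .M k, .M i, .V j γ, e => Γ.C k i j γ e
  | .V k η, .V i α, .T γ, e =>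
      kron α η * Γ.G k i γ e - kron k i * christoffel S.h α η γ e.1
  | .V k η, .V i α, .M j, e => kron α η * Γ.L k i j e
  | .V k η, .V i α, .V j γ, e => kron α η * Γ.C k i j γ e
  | _, _, _, _ => 0

/-- The covariant derivative `∇_X Y` of vector fields on the jet space. -/
def nabla (Γ : HNormalConnection p n) (X Y : JetCoord p n → JetCoord p n)
    (e : JetCoord p n) : JetCoord p n :=
  ∑ d, (fderiv ℝ (fun e' => S.coframe d e' (Y e')) e (X e)
    + ∑ a, ∑ b, S.coeff Γ d a b e * S.coframe a e (Y e) * S.coframe b e (X e)) • S.frame d e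

/-- The torsion `∇_X Y - ∇_Y X - [X, Y]`. -/
def torsion (Γ : HNormalConnection p n) (X Y : JetCoord p n → JetCoord p n)
    (e : JetCoord p n) : JetCoord p n :=
  S.nabla Γ X Y e - S.nabla Γ Y X e - VectorField.lieBracket ℝ X Y e

/-- The curvature `R(X, Y) Z = ∇_X ∇_Y Z - ∇_Y ∇_X Z - ∇_{[X, Y]} Z`. -/
def curvature (Γ : HNormalConnection p n) (X Y Z : JetCoord p n → JetCoord p n)
    (e : JetCoord p n) : JetCoord p n :=
  S.nabla Γ X (S.nabla Γ Y Z) e - S.nabla Γ Y (S.nabla Γ X Z) e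
    - S.nabla Γ (VectorField.lieBracket ℝ X Y) Z e

/-- The adapted components `T^D_{BC}` in `T(X_C, X_B) = T^D_{BC} X_D`. -/
def torsionComp (Γ : HNormalConnection p n) (d b c : JetIdx p n) (e : JetCoord p n) : ℝ :=
  S.coframe d e (S.torsion Γ (S.frame c) (S.frame b) e)

/-- The adapted components `R^D_{ABC}` in `R(X_C, X_B) X_A = R^D_{ABC} X_D`. -/
def curvComp (Γ : HNormalConnection p n) (d a b c : JetIdx p n) (e : JetCoord p n) : ℝ :=
  S.coframe d e (S.curvature Γ (S.frame c) (S.frame b) (S.frame a) e)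

/-- `Γ` is the Cartan canonical connection: the `h`-normal `Γ`-linear connection with
`g_{ij|k} = 0`, `g_{ij}|^{(γ)}_{(k)} = 0`, `G^k_{jγ} = (1/2) g^{km} δg_{mj}/δt^γ`,
`L^k_{ij} = L^k_{ji}` and `C^{i(γ)}_{j(k)} = C^{i(γ)}_{k(j)}`. -/
structure IsCartan (Γ : HNormalConnection p n) : Prop where
  metric_M : ∀ e ∈ S.domain, ∀ i j k,
    S.D (.M k) (fun e' => S.g e' i j) e
      - ∑ m, S.g e m j * Γ.L m i k e - ∑ m, S.g e i m * Γ.L m j k e = 0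
  metric_V : ∀ e ∈ S.domain, ∀ i j k γ,
    S.D (.V k γ) (fun e' => S.g e' i j) e
      - ∑ m, S.g e m j * Γ.C m i k γ e - ∑ m, S.g e i m * Γ.C m j k γ e = 0
  temporal : ∀ e ∈ S.domain, ∀ k j γ,
    Γ.G k j γ e = (1 / 2) * ∑ m, (S.g e)⁻¹ k m * S.D (.T γ) (fun e' => S.g e' m j) e
  symm_L : ∀ e ∈ S.domain, ∀ k i j, Γ.L k i j e = Γ.L k j i e
  symm_C : ∀ e ∈ S.domain, ∀ i j k γ, Γ.C i j k γ e = Γ.C i k j γ e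

/-- `σ_γ = δσ/δt^γ`. -/
def σT (γ : Fin p) (e : JetCoord p n) : ℝ := S.D (.T γ) S.σ e

/-- `σ_k = δσ/δx^k`. -/
def σM (k : Fin n) (e : JetCoord p n) : ℝ := S.D (.M k) S.σ e

/-- `σ^{(γ)}_{(k)} = ∂σ/∂x^k_γ`. -/
def σV (k : Fin n) (γ : Fin p) (e : JetCoord p n) : ℝ := S.D (.V k γ) S.σ e

/-- `Λ^k_{ij} = σ_i δ^k_j + σ_j δ^k_i - φ_{ij} σ^k`, with `σ^k = φ^{km} σ_m`. -/
def Lam (k i j : Fin n) (e : JetCoord p n) : ℝ :=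
  S.σM i e * kron k j + S.σM j e * kron k i
    - S.φ e.2.1 i j * ∑ m, (S.φ e.2.1)⁻¹ k m * S.σM m e

/-- `C^{i(γ)}_{j(k)} = σ^{(γ)}_{(k)} δ^i_j + σ^{(γ)}_{(j)} δ^i_k - φ_{jk} σ^{iγ}`, with
`σ^{iγ} = φ^{im} σ^{(γ)}_{(m)}`. -/
def Cten (i j k : Fin n) (γ : Fin p) (e : JetCoord p n) : ℝ :=
  S.σV k γ e * kron i j + S.σV j γ e * kron i k
    - S.φ e.2.1 j k * ∑ m, (S.φ e.2.1)⁻¹ i m * S.σV m γ e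

/-- The Berwald connection `BΓ = (H^γ_{αβ}, 0, γ^i_{jk}, 0)`. -/
def berwald : HNormalConnection p n where
  G _ _ _ _ := 0
  L k i j e := christoffel S.φ k i j e.2.1
  C _ _ _ _ _ := 0

/-- The local covariant derivative of a d-tensor `A_i` in the direction `δ/δt^β`. -/
def covT1 (Γ : HNormalConnection p n) (A : Fin n → JetCoord p n → ℝ) (i : Fin n) (β : Fin p)
    (e : JetCoord p n) : ℝ :=
  S.D (.T β) (A i) e - ∑ m, A m e * Γ.G m i β e

/-- The local covariant derivative of a d-tensor `A^l_{ij}` in the direction `δ/δx^k`. -/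
def covM3 (Γ : HNormalConnection p n) (A : Fin n → Fin n → Fin n → JetCoord p n → ℝ)
    (l i j k : Fin n) (e : JetCoord p n) : ℝ :=
  S.D (.M k) (A l i j) e + ∑ m, A m i j e * Γ.L l m k e
    - ∑ m, A l m j e * Γ.L m i k e - ∑ m, A l i m e * Γ.L m j k e

/-- The local covariant derivative of a d-tensor `A^l_{ij}` in the direction `∂/∂x^k_γ`. -/
def covV3 (Γ : HNormalConnection p n) (A : Fin n → Fin n → Fin n → JetCoord p n → ℝ)
    (l i j k : Fin n) (γ : Fin p) (e : JetCoord p n) : ℝ :=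
  S.D (.V k γ) (A l i j) e + ∑ m, A m i j e * Γ.C l m k γ e
    - ∑ m, A l m j e * Γ.C m i k γ e - ∑ m, A l i m e * Γ.C m j k γ e

/-- The local covariant derivative of a d-tensor `A^{l(γ)}_{i(k)}` (written `A l i k γ`) in the
direction `δ/δx^j`. -/
def covM4 (Γ : HNormalConnection p n)
    (A : Fin n → Fin n → Fin n → Fin p → JetCoord p n → ℝ)
    (l i k : Fin n) (γ : Fin p) (j : Fin n) (e : JetCoord p n) : ℝ :=
  S.D (.M j) (A l i k γ) e + ∑ m, A m i k γ e * Γ.L l m j e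
    - ∑ m, A l m k γ e * Γ.L m i j e - ∑ m, A l i m γ e * Γ.L m k j e

/-- The local covariant derivative of a d-tensor `A^{l(β)}_{i(j)}` (written `A l i j β`) in the
direction `∂/∂x^k_γ`. -/
def covV4 (Γ : HNormalConnection p n)
    (A : Fin n → Fin n → Fin n → Fin p → JetCoord p n → ℝ)
    (l i j : Fin n) (β : Fin p) (k : Fin n) (γ : Fin p) (e : JetCoord p n) : ℝ :=
  S.D (.V k γ) (A l i j β) e + ∑ m, A m i j β e * Γ.C l m k γ e
    - ∑ m, A l m j β e * Γ.C m i k γ e - ∑ m, A l i m β e * Γ.C m j k γ e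

end GRGML

end

/-! Expanded in the adapted frame, the curvature is `X_C Γ_B - X_B Γ_C`, plus the commutator of the
coefficient matrices, minus the coefficients evaluated on `[X_C, X_B]` (`curvComp_eq`). The theorem
is this expression computed from three inputs.

Coefficients. Metric compatibility and symmetry determine `L` and `C` by the Koszul argument
(`eq_of_metric`). After division by `e^{2σ}`, the derivative of the metric is `∂φ` plus `2 dσ φ`.
The Christoffel symbols of `φ` account for the first term and the tensors `Λ`, `C` for the second
(`conformal_metric`), so `L = γ + Λ` and `C` is as displayed. Since `φ` does not depend on `t`, `G`
is the scalar matrix `σ_γ δ`.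

Brackets. The `t` and `x` blocks of every frame field are constant, so all brackets are vertical.
Their components are curvatures of `h` or `φ` contracted with the fibre coordinate, single
Christoffel symbols, or zero.

Commutators on `σ`. Second derivatives of `σ` along the frame commute up to the bracket
(`D_comm_σ`). This produces the term in `σ^{(μ)}_{(m)}` of `R^l_{iβγ}` and the exchange of
derivatives behind `R^l_{iβk}`.

The reduction to seven tensors is structural: the coefficients preserve the type of a frame field,
and on vertical fields they are those of the tensor product of the spatial connection with the dual
of the temporal one (`coeff_V_V`, `IsCartan.curvComp_V_V`). -/

theorem sum_kron_mul {ι : Type} [Fintype ι] [DecidableEq ι] (a : ι) (f : ι → ℝ) :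
    ∑ b, kron a b * f b = f a := by
  simp [kron]

theorem sum_mul_kron {ι : Type} [Fintype ι] [DecidableEq ι] (a : ι) (f : ι → ℝ) :
    ∑ b, f b * kron a b = f a := by
  simp [kron]

theorem sum_kron_mul' {ι : Type} [Fintype ι] [DecidableEq ι] (a : ι) (f : ι → ℝ) :
    ∑ b, kron b a * f b = f a := by
  simp [kron]

theorem sum_mul_kron' {ι : Type} [Fintype ι] [DecidableEq ι] (a : ι) (f : ι → ℝ) :
    ∑ b, f b * kron b a = f a := by
  simp [kron]

namespace JetIdx

variable {p n : ℕ}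

/-- The adapted indices as a disjoint union. -/
def equivSum : JetIdx p n ≃ Fin p ⊕ Fin n ⊕ Fin n × Fin p where
  toFun
    | .T α => .inl α
    | .M i => .inr (.inl i)
    | .V i α => .inr (.inr (i, α))
  invFun
    | .inl α => .T α
    | .inr (.inl i) => .M i
    | .inr (.inr (i, α)) => .V i α
  left_inv x := by cases x <;> rfl
  right_inv x := by rcases x with _ | _ | ⟨_, _⟩ <;> rfl

theorem sum_eq {E : Type*} [AddCommMonoid E] (f : JetIdx p n → E) :
    ∑ a, f a = ∑ α, f (.T α) + (∑ i, f (.M i) + ∑ i, ∑ α, f (.V i α)) := by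
  rw [← equivSum.symm.sum_comp f, Fintype.sum_sum_type, Fintype.sum_sum_type,
    Fintype.sum_prod_type]
  rfl

end JetIdx

/-! ### Smoothness and Christoffel symbols of a metric; the Koszul argument -/

section Metric

variable {m : ℕ}

theorem IsSemiRiemannianOn.contDiffAt {g : (Fin m → ℝ) → Matrix (Fin m) (Fin m) ℝ}
    {U : Set (Fin m → ℝ)} (hg : IsSemiRiemannianOn g U) (hU : IsOpen U) {x : Fin m → ℝ}
    (hx : x ∈ U) (i j : Fin m) : ContDiffAt ℝ ∞ (fun y => g y i j) x :=
  (hg.smooth i j).contDiffAt (hU.mem_nhds hx)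

theorem ContDiffAt.matrix_det {k : ℕ} {E : Type*} [NormedAddCommGroup E] [NormedSpace ℝ E]
    {g : E → Matrix (Fin k) (Fin k) ℝ} {x : E}
    (hg : ∀ i j, ContDiffAt ℝ ∞ (fun y => g y i j) x) :
    ContDiffAt ℝ ∞ (fun y => (g y).det) x := by
  simp only [Matrix.det_apply']
  exact ContDiffAt.sum fun s _ => contDiffAt_const.mul (contDiffAt_prod fun i _ => hg _ _)

/-- Cramer's rule: an adjugate entry is the determinant of `g` with one row replaced by a constant
unit vector, hence smooth, and the determinant is nonzero at `x`. -/
theorem ContDiffAt.matrix_inv {k : ℕ} {E : Type*} [NormedAddCommGroup E] [NormedSpace ℝ E]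
    {g : E → Matrix (Fin k) (Fin k) ℝ} {x : E}
    (hg : ∀ i j, ContDiffAt ℝ ∞ (fun y => g y i j) x) (hx : IsUnit (g x).det) (i j : Fin k) :
    ContDiffAt ℝ ∞ (fun y => (g y)⁻¹ i j) x := by
  have hadj : ContDiffAt ℝ ∞ (fun y => (g y).adjugate i j) x := by
    simp only [Matrix.adjugate_apply]
    refine ContDiffAt.matrix_det fun a b => ?_
    by_cases h : a = j
    · subst h
      simpa using contDiffAt_const
    · simpa [Matrix.updateRow_ne h] using hg a b
  have := ((ContDiffAt.matrix_det hg).inv hx.ne_zero).mul hadj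
  simpa [Matrix.inv_def, Ring.inverse_eq_inv'] using this

theorem ContDiffAt.partialDeriv {f : (Fin m → ℝ) → ℝ} {x : Fin m → ℝ}
    (hf : ContDiffAt ℝ ∞ f x) (k : Fin m) : ContDiffAt ℝ ∞ (partialDeriv f k) x :=
  (hf.fderiv_right (m := ∞) (by simp)).clm_apply contDiffAt_const

theorem IsSemiRiemannianOn.contDiffAt_inv {g : (Fin m → ℝ) → Matrix (Fin m) (Fin m) ℝ}
    {U : Set (Fin m → ℝ)} (hg : IsSemiRiemannianOn g U) (hU : IsOpen U) {x : Fin m → ℝ}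
    (hx : x ∈ U) (i j : Fin m) : ContDiffAt ℝ ∞ (fun y => (g y)⁻¹ i j) x :=
  ContDiffAt.matrix_inv (hg.contDiffAt hU hx) (hg.nondegenerate x hx) i j

theorem IsSemiRiemannianOn.contDiffAt_christoffel
    {g : (Fin m → ℝ) → Matrix (Fin m) (Fin m) ℝ}
    {U : Set (Fin m → ℝ)} (hg : IsSemiRiemannianOn g U) (hU : IsOpen U) {x : Fin m → ℝ}
    (hx : x ∈ U) (l i j : Fin m) : ContDiffAt ℝ ∞ (christoffel g l i j) x := by
  have h := hg.contDiffAt hU hx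
  exact contDiffAt_const.mul (ContDiffAt.sum fun r _ => (hg.contDiffAt_inv hU hx l r).mul
    ((((h j r).partialDeriv i).add ((h i r).partialDeriv j)).sub ((h i j).partialDeriv r)))

theorem IsSemiRiemannianOn.partialDeriv_symm {g : (Fin m → ℝ) → Matrix (Fin m) (Fin m) ℝ}
    {U : Set (Fin m → ℝ)} (hg : IsSemiRiemannianOn g U) (hU : IsOpen U) {x : Fin m → ℝ}
    (hx : x ∈ U) (i j k : Fin m) :
    partialDeriv (fun y => g y i j) k x = partialDeriv (fun y => g y j i) k x := by
  have : (fun y => g y i j) =ᶠ[nhds x] fun y => g y j i := by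
    filter_upwards [hU.mem_nhds hx] with y hy
    exact (hg.symm y hy).apply j i
  simp only [partialDeriv, this.fderiv_eq]

theorem IsSemiRiemannianOn.christoffel_symm {g : (Fin m → ℝ) → Matrix (Fin m) (Fin m) ℝ}
    {U : Set (Fin m → ℝ)} (hg : IsSemiRiemannianOn g U) (hU : IsOpen U) {x : Fin m → ℝ}
    (hx : x ∈ U) (l i j : Fin m) : christoffel g l i j x = christoffel g l j i x := by
  simp only [christoffel, hg.partialDeriv_symm hU hx i j]
  congr 1
  exact Finset.sum_congr rfl fun r _ => by ring

theorem sum_mul_inv_mul {A : Matrix (Fin m) (Fin m) ℝ} (hA : IsUnit A.det) (j : Fin m)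
    (v : Fin m → ℝ) : ∑ k, A j k * ∑ r, A⁻¹ k r * v r = v j := by
  have : A.mulVec (A⁻¹.mulVec v) = v := by
    rw [Matrix.mulVec_mulVec, Matrix.mul_nonsing_inv _ hA, Matrix.one_mulVec]
  exact congrFun this j

theorem IsSemiRiemannianOn.sum_mul_christoffel {g : (Fin m → ℝ) → Matrix (Fin m) (Fin m) ℝ}
    {U : Set (Fin m → ℝ)} (hg : IsSemiRiemannianOn g U) {x : Fin m → ℝ}
    (hx : x ∈ U) (l i j : Fin m) :
    ∑ k, g x l k * christoffel g k i j x =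
      (1 / 2) * (partialDeriv (fun y => g y j l) i x + partialDeriv (fun y => g y i l) j x
        - partialDeriv (fun y => g y i j) l x) := by
  rw [← sum_mul_inv_mul (hg.nondegenerate x hx) l (fun l => partialDeriv (fun y => g y j l) i x
    + partialDeriv (fun y => g y i l) j x - partialDeriv (fun y => g y i j) l x), Finset.mul_sum]
  exact Finset.sum_congr rfl fun r _ => by rw [christoffel]; ring

/-- This is `∇g = 0` for the Levi-Civita connection. Of the six first derivatives given by the
lowered symbols, four cancel by symmetry of `g` and two agree. -/
theorem IsSemiRiemannianOn.christoffel_metric {g : (Fin m → ℝ) → Matrix (Fin m) (Fin m) ℝ}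
    {U : Set (Fin m → ℝ)} (hg : IsSemiRiemannianOn g U) (hU : IsOpen U) {x : Fin m → ℝ}
    (hx : x ∈ U) (i j k : Fin m) :
    ∑ r, g x j r * christoffel g r i k x + ∑ r, g x i r * christoffel g r j k x
      = partialDeriv (fun y => g y i j) k x := by
  rw [hg.sum_mul_christoffel hx, hg.sum_mul_christoffel hx, hg.partialDeriv_symm hU hx k j,
    hg.partialDeriv_symm hU hx k i, hg.partialDeriv_symm hU hx j i]
  ring

/-- A symmetric coefficient is determined by the derivative of the metric it preserves. -/
theorem eq_of_metric {A : Matrix (Fin m) (Fin m) ℝ} (hA : IsUnit A.det)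
    {L L' : Fin m → Fin m → Fin m → ℝ} (hL : ∀ k i j, L k i j = L k j i)
    (hL' : ∀ k i j, L' k i j = L' k j i)
    (h : ∀ i j k, ∑ r, A j r * L r i k + ∑ r, A i r * L r j k
      = ∑ r, A j r * L' r i k + ∑ r, A i r * L' r j k) : L = L' := by
  set d : Fin m → Fin m → Fin m → ℝ := fun j i k => ∑ r, A j r * (L r i k - L' r i k) with hd
  have hanti : ∀ i j k, d j i k + d i j k = 0 := by
    intro i j k
    simp only [hd, mul_sub, Finset.sum_sub_distrib]
    linarith [h i j k]
  have hsymm : ∀ i j k, d i j k = d i k j := by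
    intro i j k
    simp only [hd]
    exact Finset.sum_congr rfl fun r _ => by rw [hL, hL']
  have hzero : ∀ i j k, d i j k = 0 := by
    intro i j k
    -- `d` is antisymmetric in its first two indices and symmetric in its last two. Alternating the
    -- two exchanges three times each returns to the same indices with sign `-1`.
    linarith [hanti i j k, hanti j k i, hanti i k j, hsymm i j k, hsymm j i k, hsymm k i j]
  funext k i j
  have hv : A.mulVec (fun r => L r i j - L' r i j) = 0 := funext fun l => hzero l i j
  have := Matrix.eq_zero_of_mulVec_eq_zero hA.ne_zero hv
  exact sub_eq_zero.mp (congrFun this k)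

/-- The conformal change of a symmetric connection preserves the conformal change of the metric. -/
theorem conformal_metric {A : Matrix (Fin m) (Fin m) ℝ} (hA : IsUnit A.det) (hs : A.IsSymm)
    (s : Fin m → ℝ) (i j k : Fin m) :
    ∑ r, A j r * (s i * kron r k + s k * kron r i - A i k * ∑ q, A⁻¹ r q * s q)
      + ∑ r, A i r * (s j * kron r k + s k * kron r j - A j k * ∑ q, A⁻¹ r q * s q)
      = 2 * s k * A i j := by
  have key : ∀ i j, ∑ r, A j r * (s i * kron r k + s k * kron r i
      - A i k * ∑ q, A⁻¹ r q * s q) = s i * A j k + s k * A j i - A i k * s j := by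
    intro i j
    have : ∀ r, A j r * (s i * kron r k + s k * kron r i - A i k * ∑ q, A⁻¹ r q * s q)
        = s i * (A j r * kron r k) + s k * (A j r * kron r i)
          - A i k * (A j r * ∑ q, A⁻¹ r q * s q) := fun r => by ring
    simp only [this, Finset.sum_sub_distrib, Finset.sum_add_distrib, ← Finset.mul_sum,
      sum_mul_kron', sum_mul_inv_mul hA]
  rw [key, key, hs.apply i j]
  ring

end Metric

/-! ### Duality of frame and coframe; curvature and torsion in adapted components -/

namespace GRGML

variable {p n : ℕ} (S : GRGML p n)

theorem isOpen_domain : IsOpen S.domain :=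
  (S.isOpen_U.preimage continuous_fst).inter
    (S.isOpen_V.preimage (continuous_fst.comp continuous_snd))

theorem coframe_frame (d a : JetIdx p n) (e : JetCoord p n) :
    S.coframe d e (S.frame a e) = kron d a := by
  cases d <;> cases a <;>
    simp [coframe, frame, kron, Pi.single_apply, apply_ite, ite_and]
  split_ifs <;> simp_all

theorem coframe_add (d : JetIdx p n) (e v w : JetCoord p n) :
    S.coframe d e (v + w) = S.coframe d e v + S.coframe d e w := by
  cases d <;> simp [coframe, mul_add, Finset.sum_add_distrib]
  ring

theorem coframe_smul (d : JetIdx p n) (e v : JetCoord p n) (c : ℝ) :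
    S.coframe d e (c • v) = c * S.coframe d e v := by
  cases d <;> simp [coframe, mul_add, Finset.mul_sum, mul_left_comm]

/-- The adapted coframe at `e` as a linear form. -/
noncomputable def coframeₗ (d : JetIdx p n) (e : JetCoord p n) : JetCoord p n →ₗ[ℝ] ℝ where
  toFun := S.coframe d e
  map_add' := S.coframe_add d e
  map_smul' c v := S.coframe_smul d e v c

theorem coframe_sub (d : JetIdx p n) (e v w : JetCoord p n) :
    S.coframe d e (v - w) = S.coframe d e v - S.coframe d e w :=
  map_sub (S.coframeₗ d e) v w

theorem coframe_neg (d : JetIdx p n) (e v : JetCoord p n) :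
    S.coframe d e (-v) = -S.coframe d e v :=
  map_neg (S.coframeₗ d e) v

theorem coframe_sum_frame (d : JetIdx p n) (e : JetCoord p n) (c : JetIdx p n → ℝ) :
    S.coframe d e (∑ a, c a • S.frame a e) = c d := by
  change S.coframeₗ d e _ = _
  rw [map_sum]
  have : ∀ a, S.coframeₗ d e (c a • S.frame a e) = c a * kron d a := fun a => by
    rw [← S.coframe_frame d a e, ← S.coframe_smul]
    rfl
  simp only [this, sum_mul_kron]

theorem coframe_nabla (Γ : HNormalConnection p n) (X Y : JetCoord p n → JetCoord p n)
    (d : JetIdx p n) (e : JetCoord p n) :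
    S.coframe d e (S.nabla Γ X Y e) = fderiv ℝ (fun e' => S.coframe d e' (Y e')) e (X e)
      + ∑ a, ∑ b, S.coeff Γ d a b e * S.coframe a e (Y e) * S.coframe b e (X e) := by
  rw [nabla, coframe_sum_frame]

theorem coframe_nabla_frame (Γ : HNormalConnection p n) (X : JetCoord p n → JetCoord p n)
    (d a : JetIdx p n) (e : JetCoord p n) :
    S.coframe d e (S.nabla Γ X (S.frame a) e)
      = ∑ b, S.coeff Γ d a b e * S.coframe b e (X e) := by
  have h : ∀ a', ∑ b, S.coeff Γ d a' b e * kron a' a * S.coframe b e (X e)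
      = kron a' a * ∑ b, S.coeff Γ d a' b e * S.coframe b e (X e) := fun a' => by
    rw [Finset.mul_sum]
    exact Finset.sum_congr rfl fun b _ => by ring
  simp only [coframe_nabla, coframe_frame, h, sum_kron_mul']
  simp

theorem coframe_nabla_frame_frame (Γ : HNormalConnection p n) (d a b : JetIdx p n)
    (e : JetCoord p n) :
    S.coframe d e (S.nabla Γ (S.frame b) (S.frame a) e) = S.coeff Γ d a b e := by
  simp only [coframe_nabla_frame, coframe_frame, sum_mul_kron']

theorem coframe_nabla_nabla_frame (Γ : HNormalConnection p n) (d a b c : JetIdx p n)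
    (e : JetCoord p n) :
    S.coframe d e (S.nabla Γ (S.frame c) (S.nabla Γ (S.frame b) (S.frame a)) e)
      = S.D c (S.coeff Γ d a b) e + ∑ f, S.coeff Γ f a b e * S.coeff Γ d f c e := by
  rw [coframe_nabla]
  simp only [coframe_nabla_frame_frame, coframe_frame, sum_mul_kron']
  refine congrArg₂ _ rfl (Finset.sum_congr rfl fun f _ => mul_comm _ _)

/-- No differentiability is needed: the component functions of `∇_{X_B} X_A` are exactly the
coefficients, so the same `fderiv` stands on both sides, and `∇` depends on its direction only
through the value at `e`. -/
theorem curvComp_eq (Γ : HNormalConnection p n) (d a b c : JetIdx p n) (e : JetCoord p n) :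
    S.curvComp Γ d a b c e = S.D c (S.coeff Γ d a b) e - S.D b (S.coeff Γ d a c) e
      + ∑ f, S.coeff Γ f a b e * S.coeff Γ d f c e - ∑ f, S.coeff Γ f a c e * S.coeff Γ d f b e
      - ∑ f, S.coeff Γ d a f e
        * S.coframe f e (VectorField.lieBracket ℝ (S.frame c) (S.frame b) e) := by
  rw [curvComp, curvature, coframe_sub, coframe_sub, coframe_nabla_nabla_frame,
    coframe_nabla_nabla_frame, coframe_nabla_frame]
  ring

theorem torsionComp_eq (Γ : HNormalConnection p n) (d b c : JetIdx p n) (e : JetCoord p n) :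
    S.torsionComp Γ d b c e = S.coeff Γ d b c e - S.coeff Γ d c b e
      - S.coframe d e (VectorField.lieBracket ℝ (S.frame c) (S.frame b) e) := by
  rw [torsionComp, torsion, coframe_sub, coframe_sub, coframe_nabla_frame_frame,
    coframe_nabla_frame_frame]

theorem coframe_lieBracket_swap (f b c : JetIdx p n) (e : JetCoord p n) :
    S.coframe f e (VectorField.lieBracket ℝ (S.frame c) (S.frame b) e)
      = -S.coframe f e (VectorField.lieBracket ℝ (S.frame b) (S.frame c) e) := by
  rw [← coframe_neg, VectorField.lieBracket, VectorField.lieBracket, neg_sub]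

theorem curvComp_swap (Γ : HNormalConnection p n) (d a b c : JetIdx p n) (e : JetCoord p n) :
    S.curvComp Γ d a b c e = -S.curvComp Γ d a c b e := by
  rw [curvComp_eq, curvComp_eq]
  simp only [S.coframe_lieBracket_swap _ b c, mul_neg, Finset.sum_neg_distrib]
  ring

/-! ### Calculus of derivatives along the adapted frame -/

/-- The Cartan coefficients are known only over the open coordinate domain; this suffices to
differentiate them there. -/
theorem D_congr {A : JetIdx p n} {f f' : JetCoord p n → ℝ} {e : JetCoord p n}
    (he : e ∈ S.domain) (h : ∀ e' ∈ S.domain, f e' = f' e') : S.D A f e = S.D A f' e := by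
  have : f =ᶠ[nhds e] f' := by
    filter_upwards [S.isOpen_domain.mem_nhds he] with e' he' using h e' he'
  rw [D, D, this.fderiv_eq]

theorem D_const (A : JetIdx p n) (c : ℝ) (e : JetCoord p n) : S.D A (fun _ => c) e = 0 := by
  simp [D]

theorem D_add {A : JetIdx p n} {f f' : JetCoord p n → ℝ} {e : JetCoord p n}
    (hf : DifferentiableAt ℝ f e) (hf' : DifferentiableAt ℝ f' e) :
    S.D A (fun e' => f e' + f' e') e = S.D A f e + S.D A f' e := by
  simp [D, fderiv_fun_add hf hf']

theorem D_sub {A : JetIdx p n} {f f' : JetCoord p n → ℝ} {e : JetCoord p n}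
    (hf : DifferentiableAt ℝ f e) (hf' : DifferentiableAt ℝ f' e) :
    S.D A (fun e' => f e' - f' e') e = S.D A f e - S.D A f' e := by
  simp [D, fderiv_fun_sub hf hf']

theorem D_mul {A : JetIdx p n} {f f' : JetCoord p n → ℝ} {e : JetCoord p n}
    (hf : DifferentiableAt ℝ f e) (hf' : DifferentiableAt ℝ f' e) :
    S.D A (fun e' => f e' * f' e') e = f e * S.D A f' e + f' e * S.D A f e := by
  simp [D, fderiv_fun_mul hf hf']

theorem D_mul_const {A : JetIdx p n} {f : JetCoord p n → ℝ} {e : JetCoord p n}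
    (hf : DifferentiableAt ℝ f e) (c : ℝ) :
    S.D A (fun e' => f e' * c) e = S.D A f e * c := by
  rw [S.D_mul hf (differentiableAt_const c), D_const]
  ring

theorem D_const_mul {A : JetIdx p n} {f : JetCoord p n → ℝ} {e : JetCoord p n}
    (hf : DifferentiableAt ℝ f e) (c : ℝ) :
    S.D A (fun e' => c * f e') e = c * S.D A f e := by
  rw [S.D_mul (differentiableAt_const c) hf, D_const]
  ring

theorem D_neg (A : JetIdx p n) (f : JetCoord p n → ℝ) (e : JetCoord p n) :
    S.D A (fun e' => -f e') e = -S.D A f e := by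
  simp [D, fderiv_fun_neg]

theorem D_sum {ι : Type*} [Fintype ι] {A : JetIdx p n} {f : ι → JetCoord p n → ℝ}
    {e : JetCoord p n} (hf : ∀ i, DifferentiableAt ℝ (f i) e) :
    S.D A (fun e' => ∑ i, f i e') e = ∑ i, S.D A (f i) e := by
  simp [D, fderiv_fun_sum fun i _ => hf i]

theorem D_comp_fst {A : JetIdx p n} {F : (Fin p → ℝ) → ℝ} {e : JetCoord p n}
    (hF : DifferentiableAt ℝ F e.1) :
    S.D A (fun e' => F e'.1) e = fderiv ℝ F e.1 (S.frame A e).1 := by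
  have h : HasFDerivAt (fun e' : JetCoord p n => F e'.1) _ e :=
    hF.hasFDerivAt.comp e hasFDerivAt_fst
  rw [D, h.fderiv]
  rfl

theorem D_comp_snd_fst {A : JetIdx p n} {F : (Fin n → ℝ) → ℝ} {e : JetCoord p n}
    (hF : DifferentiableAt ℝ F e.2.1) :
    S.D A (fun e' => F e'.2.1) e = fderiv ℝ F e.2.1 (S.frame A e).2.1 := by
  have h : HasFDerivAt (fun e' : JetCoord p n => F e'.2.1) _ e :=
    hF.hasFDerivAt.comp e (hasFDerivAt_fst.comp e hasFDerivAt_snd)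
  rw [D, h.fderiv]
  rfl

theorem D_T_comp_fst {γ : Fin p} {F : (Fin p → ℝ) → ℝ} {e : JetCoord p n}
    (hF : DifferentiableAt ℝ F e.1) :
    S.D (.T γ) (fun e' => F e'.1) e = partialDeriv F γ e.1 := S.D_comp_fst hF

theorem D_M_comp_fst {k : Fin n} {F : (Fin p → ℝ) → ℝ} {e : JetCoord p n}
    (hF : DifferentiableAt ℝ F e.1) :
    S.D (.M k) (fun e' => F e'.1) e = 0 := (S.D_comp_fst hF).trans (map_zero _)

theorem D_V_comp_fst {k : Fin n} {γ : Fin p} {F : (Fin p → ℝ) → ℝ} {e : JetCoord p n}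
    (hF : DifferentiableAt ℝ F e.1) :
    S.D (.V k γ) (fun e' => F e'.1) e = 0 := (S.D_comp_fst hF).trans (map_zero _)

theorem D_T_comp_snd_fst {γ : Fin p} {F : (Fin n → ℝ) → ℝ} {e : JetCoord p n}
    (hF : DifferentiableAt ℝ F e.2.1) :
    S.D (.T γ) (fun e' => F e'.2.1) e = 0 := (S.D_comp_snd_fst hF).trans (map_zero _)

theorem D_M_comp_snd_fst {k : Fin n} {F : (Fin n → ℝ) → ℝ} {e : JetCoord p n}
    (hF : DifferentiableAt ℝ F e.2.1) :
    S.D (.M k) (fun e' => F e'.2.1) e = partialDeriv F k e.2.1 := S.D_comp_snd_fst hF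

theorem D_V_comp_snd_fst {k : Fin n} {γ : Fin p} {F : (Fin n → ℝ) → ℝ} {e : JetCoord p n}
    (hF : DifferentiableAt ℝ F e.2.1) :
    S.D (.V k γ) (fun e' => F e'.2.1) e = 0 := (S.D_comp_snd_fst hF).trans (map_zero _)

/-- The coordinate `x^m_μ` as a continuous linear form. -/
def fiberCoord (m : Fin n) (μ : Fin p) : JetCoord p n →L[ℝ] ℝ :=
  (ContinuousLinearMap.proj (R := ℝ) (φ := fun _ : Fin p => ℝ) μ).comp
    ((ContinuousLinearMap.proj (R := ℝ) (φ := fun _ : Fin n => Fin p → ℝ) m).comp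
      ((ContinuousLinearMap.snd ℝ (Fin n → ℝ) (Fin n → Fin p → ℝ)).comp
        (ContinuousLinearMap.snd ℝ (Fin p → ℝ) ((Fin n → ℝ) × (Fin n → Fin p → ℝ)))))

theorem contDiff_fiberCoord (m : Fin n) (μ : Fin p) :
    ContDiff ℝ ∞ (fun e : JetCoord p n => e.2.2 m μ) :=
  (fiberCoord m μ).contDiff

theorem D_fiberCoord (A : JetIdx p n) (m : Fin n) (μ : Fin p) (e : JetCoord p n) :
    S.D A (fun e' => e'.2.2 m μ) e = (S.frame A e).2.2 m μ := by
  change fderiv ℝ (fiberCoord m μ) e _ = _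
  rw [ContinuousLinearMap.fderiv]
  rfl

section Smooth

variable {S} {e : JetCoord p n} (he : e ∈ S.domain)
include he

theorem contDiffAt_σ : ContDiffAt ℝ ∞ S.σ e :=
  S.σ_smooth.contDiffAt (S.isOpen_domain.mem_nhds he)

theorem contDiffAt_φ (i j : Fin n) : ContDiffAt ℝ ∞ (fun e' => S.φ e'.2.1 i j) e :=
  (S.φ_metric.contDiffAt S.isOpen_V he.2 i j).comp (f := fun e' : JetCoord p n => e'.2.1) e
    (contDiff_fst.comp contDiff_snd).contDiffAt

end Smooth

end GRGML

/-! ### Vertical parts of the frame; smoothness of the frame, `Λ` and `C` -/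

namespace GRGML

variable {p n : ℕ} (S : GRGML p n)

theorem frame_T_vert (β : Fin p) (m : Fin n) (μ : Fin p) (e : JetCoord p n) :
    (S.frame (.T β) e).2.2 m μ = ∑ ε, christoffel S.h ε μ β e.1 * e.2.2 m ε :=
  neg_neg _

theorem frame_M_vert (j : Fin n) (m : Fin n) (μ : Fin p) (e : JetCoord p n) :
    (S.frame (.M j) e).2.2 m μ = -∑ q, christoffel S.φ m j q e.2.1 * e.2.2 q μ :=
  rfl

theorem frame_V_vert (j : Fin n) (γ : Fin p) (m : Fin n) (μ : Fin p) (e : JetCoord p n) :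
    (S.frame (.V j γ) e).2.2 m μ = kron m j * kron μ γ := by
  simp [frame, kron, Pi.single_apply, apply_ite]
  split_ifs <;> simp_all

section Smooth

variable {S} {e : JetCoord p n} (he : e ∈ S.domain)
include he

theorem contDiffAt_φ_inv (i j : Fin n) : ContDiffAt ℝ ∞ (fun e' => (S.φ e'.2.1)⁻¹ i j) e :=
  (S.φ_metric.contDiffAt_inv S.isOpen_V he.2 i j).comp (f := fun e' : JetCoord p n => e'.2.1) e
    (contDiff_fst.comp contDiff_snd).contDiffAt

theorem contDiffAt_christoffel_φ (l i j : Fin n) :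
    ContDiffAt ℝ ∞ (fun e' => christoffel S.φ l i j e'.2.1) e :=
  (S.φ_metric.contDiffAt_christoffel S.isOpen_V he.2 l i j).comp
    (f := fun e' : JetCoord p n => e'.2.1) e (contDiff_fst.comp contDiff_snd).contDiffAt

theorem contDiffAt_christoffel_h (l i j : Fin p) :
    ContDiffAt ℝ ∞ (fun e' => christoffel S.h l i j e'.1) e :=
  (S.h_metric.contDiffAt_christoffel S.isOpen_U he.1 l i j).comp
    (f := fun e' : JetCoord p n => e'.1) e contDiff_fst.contDiffAt

theorem contDiffAt_frame_vert (b : JetIdx p n) (m : Fin n) (μ : Fin p) :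
    ContDiffAt ℝ ∞ (fun e' => (S.frame b e').2.2 m μ) e := by
  cases b with
  | T β =>
    simp only [frame_T_vert]
    exact ContDiffAt.sum fun ε _ =>
      (contDiffAt_christoffel_h he _ _ _).mul (contDiff_fiberCoord m ε).contDiffAt
  | M j =>
    simp only [frame_M_vert]
    exact (ContDiffAt.sum fun q _ =>
      (contDiffAt_christoffel_φ he _ _ _).mul (contDiff_fiberCoord q μ).contDiffAt).neg
  | V j γ => exact contDiffAt_const

theorem contDiffAt_frame (b : JetIdx p n) : ContDiffAt ℝ ∞ (S.frame b) e := by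
  have h1 : ContDiffAt ℝ ∞ (fun e' => (S.frame b e').1) e := by
    cases b <;> exact contDiffAt_const
  have h2 : ContDiffAt ℝ ∞ (fun e' => (S.frame b e').2.1) e := by
    cases b <;> exact contDiffAt_const
  exact h1.prodMk (h2.prodMk (contDiffAt_pi.2 fun m => contDiffAt_pi.2 fun μ =>
    contDiffAt_frame_vert he b m μ))

theorem contDiffAt_D_σ (b : JetIdx p n) : ContDiffAt ℝ ∞ (S.D b S.σ) e :=
  ((contDiffAt_σ he).fderiv_right (m := ∞) (by simp)).clm_apply (contDiffAt_frame he b)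

theorem contDiffAt_Lam (k i j : Fin n) : ContDiffAt ℝ ∞ (S.Lam k i j) e :=
  (((contDiffAt_D_σ he _).mul contDiffAt_const).add
    ((contDiffAt_D_σ he _).mul contDiffAt_const)).sub ((contDiffAt_φ he i j).mul
      (ContDiffAt.sum fun m _ => (contDiffAt_φ_inv he k m).mul (contDiffAt_D_σ he (.M m))))

theorem contDiffAt_Cten (i j k : Fin n) (γ : Fin p) : ContDiffAt ℝ ∞ (S.Cten i j k γ) e :=
  (((contDiffAt_D_σ he _).mul contDiffAt_const).add
    ((contDiffAt_D_σ he _).mul contDiffAt_const)).sub ((contDiffAt_φ he j k).mul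
      (ContDiffAt.sum fun m _ => (contDiffAt_φ_inv he i m).mul (contDiffAt_D_σ he (.V m γ))))

end Smooth

theorem D_frame_V_vert (A : JetIdx p n) (j : Fin n) (γ : Fin p) (m : Fin n) (μ : Fin p) :
    S.D A (fun e' => (S.frame (.V j γ) e').2.2 m μ) e = 0 := by
  simp only [frame_V_vert, D_const]

/-! ### Lie brackets of the adapted frame -/

section Bracket

variable {S} {e : JetCoord p n} (he : e ∈ S.domain)
include he

/-- The temporal and spatial blocks of a frame field are constant; this is why every bracket below
is vertical. -/
theorem fderiv_frame (b : JetIdx p n) (v : JetCoord p n) :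
    fderiv ℝ (S.frame b) e v
      = (0, 0, fun m μ => fderiv ℝ (fun e' => (S.frame b e').2.2 m μ) e v) := by
  have hd := ((contDiffAt_frame he b).differentiableAt (by simp)).hasFDerivAt
  refine Prod.ext ?_ (Prod.ext ?_ (funext fun m => funext fun μ => ?_))
  · have h1 : HasFDerivAt (fun e' => (S.frame b e').1) (0 : JetCoord p n →L[ℝ] _) e := by
      cases b <;> exact hasFDerivAt_const _ _
    exact congrArg (fun L => L v) (hd.fst.unique h1)
  · have h1 : HasFDerivAt (fun e' => (S.frame b e').2.1) (0 : JetCoord p n →L[ℝ] _) e := by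
      cases b <;> exact hasFDerivAt_const _ _
    exact congrArg (fun L => L v) (hd.snd.fst.unique h1)
  · have h1 : HasFDerivAt (fun e' => (S.frame b e').2.2 m μ) _ e :=
      (fiberCoord m μ).hasFDerivAt.comp e hd
    change _ = fderiv ℝ (fun e' => (S.frame b e').2.2 m μ) e v
    rw [h1.fderiv]
    rfl

theorem lieBracket_frame (b c : JetIdx p n) :
    VectorField.lieBracket ℝ (S.frame c) (S.frame b) e
      = (0, 0, fun m μ => S.D c (fun e' => (S.frame b e').2.2 m μ) e
          - S.D b (fun e' => (S.frame c e').2.2 m μ) e) := by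
  rw [VectorField.lieBracket, fderiv_frame he, fderiv_frame he]
  simp only [Prod.mk_sub_mk, sub_zero]
  rfl

theorem coframe_T_lieBracket (b c : JetIdx p n) (α : Fin p) :
    S.coframe (.T α) e (VectorField.lieBracket ℝ (S.frame c) (S.frame b) e) = 0 := by
  rw [lieBracket_frame he]
  rfl

theorem coframe_M_lieBracket (b c : JetIdx p n) (i : Fin n) :
    S.coframe (.M i) e (VectorField.lieBracket ℝ (S.frame c) (S.frame b) e) = 0 := by
  rw [lieBracket_frame he]
  rfl

theorem coframe_V_lieBracket (b c : JetIdx p n) (m : Fin n) (μ : Fin p) :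
    S.coframe (.V m μ) e (VectorField.lieBracket ℝ (S.frame c) (S.frame b) e)
      = S.D c (fun e' => (S.frame b e').2.2 m μ) e
        - S.D b (fun e' => (S.frame c e').2.2 m μ) e := by
  rw [lieBracket_frame he]
  simp [coframe]

theorem sum_lieBracket (b c : JetIdx p n) (f : JetIdx p n → ℝ) :
    ∑ a, f a * S.coframe a e (VectorField.lieBracket ℝ (S.frame c) (S.frame b) e)
      = ∑ m, ∑ μ, f (.V m μ)
        * S.coframe (.V m μ) e (VectorField.lieBracket ℝ (S.frame c) (S.frame b) e) := by
  rw [JetIdx.sum_eq]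
  simp [coframe_T_lieBracket he, coframe_M_lieBracket he]

theorem D_frame_T_vert (A : JetIdx p n) (β : Fin p) (m : Fin n) (μ : Fin p) :
    S.D A (fun e' => (S.frame (.T β) e').2.2 m μ) e
      = ∑ ε, (christoffel S.h ε μ β e.1 * (S.frame A e).2.2 m ε
        + e.2.2 m ε * S.D A (fun e' => christoffel S.h ε μ β e'.1) e) := by
  have h1 : ∀ ε, DifferentiableAt ℝ (fun e' : JetCoord p n => christoffel S.h ε μ β e'.1) e :=
    fun ε => (contDiffAt_christoffel_h he _ _ _).differentiableAt (by simp)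
  have h2 : ∀ ε, DifferentiableAt ℝ (fun e' : JetCoord p n => e'.2.2 m ε) e :=
    fun ε => (contDiff_fiberCoord m ε).contDiffAt.differentiableAt (by simp)
  simp only [frame_T_vert]
  rw [S.D_sum (f := fun ε e' => christoffel S.h ε μ β e'.1 * e'.2.2 m ε)
    fun ε => (h1 ε).mul (h2 ε)]
  refine Finset.sum_congr rfl fun ε _ => ?_
  rw [S.D_mul (h1 ε) (h2 ε), D_fiberCoord]

theorem D_frame_M_vert (A : JetIdx p n) (j : Fin n) (m : Fin n) (μ : Fin p) :
    S.D A (fun e' => (S.frame (.M j) e').2.2 m μ) e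
      = -∑ q, (christoffel S.φ m j q e.2.1 * (S.frame A e).2.2 q μ
        + e.2.2 q μ * S.D A (fun e' => christoffel S.φ m j q e'.2.1) e) := by
  have h1 : ∀ q, DifferentiableAt ℝ (fun e' : JetCoord p n => christoffel S.φ m j q e'.2.1) e :=
    fun q => (contDiffAt_christoffel_φ he _ _ _).differentiableAt (by simp)
  have h2 : ∀ q, DifferentiableAt ℝ (fun e' : JetCoord p n => e'.2.2 q μ) e :=
    fun q => (contDiff_fiberCoord q μ).contDiffAt.differentiableAt (by simp)
  simp only [frame_M_vert]
  rw [D_neg, S.D_sum (f := fun q e' => christoffel S.φ m j q e'.2.1 * e'.2.2 q μ)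
    fun q => (h1 q).mul (h2 q)]
  congr 1
  refine Finset.sum_congr rfl fun q _ => ?_
  rw [S.D_mul (h1 q) (h2 q), D_fiberCoord]

theorem differentiableAt_christoffel_h (l i j : Fin p) :
    DifferentiableAt ℝ (christoffel S.h l i j) e.1 :=
  (S.h_metric.contDiffAt_christoffel S.isOpen_U he.1 l i j).differentiableAt (by simp)

theorem differentiableAt_christoffel_φ (l i j : Fin n) :
    DifferentiableAt ℝ (christoffel S.φ l i j) e.2.1 :=
  (S.φ_metric.contDiffAt_christoffel S.isOpen_V he.2 l i j).differentiableAt (by simp)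

theorem christoffel_φ_symm (l i j : Fin n) :
    christoffel S.φ l i j e.2.1 = christoffel S.φ l j i e.2.1 :=
  S.φ_metric.christoffel_symm S.isOpen_V he.2 l i j

theorem coframe_lieBracket_TT (m : Fin n) (μ β γ : Fin p) :
    S.coframe (.V m μ) e (VectorField.lieBracket ℝ (S.frame (.T γ)) (S.frame (.T β)) e)
      = ∑ ε, metricCurvature S.h ε μ β γ e.1 * e.2.2 m ε := by
  have h : ∀ β γ : Fin p, ∑ ε, christoffel S.h ε μ β e.1
      * ∑ ν, christoffel S.h ν ε γ e.1 * e.2.2 m ν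
      = ∑ ε, (∑ s, christoffel S.h s μ β e.1 * christoffel S.h ε s γ e.1) * e.2.2 m ε := by
    intro β γ
    simp only [Finset.mul_sum, Finset.sum_mul, mul_assoc]
    exact Finset.sum_comm
  simp only [coframe_V_lieBracket he, D_frame_T_vert he]
  simp only [frame_T_vert,
    S.D_T_comp_fst (differentiableAt_christoffel_h he _ _ _), Finset.sum_add_distrib, h,
    metricCurvature]
  rw [← Finset.sum_add_distrib, ← Finset.sum_add_distrib, ← Finset.sum_sub_distrib]
  exact Finset.sum_congr rfl fun ε _ => by ring

theorem coframe_lieBracket_MM (m : Fin n) (μ : Fin p) (j k : Fin n) :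
    S.coframe (.V m μ) e (VectorField.lieBracket ℝ (S.frame (.M k)) (S.frame (.M j)) e)
      = -∑ q, metricCurvature S.φ m q j k e.2.1 * e.2.2 q μ := by
  have h : ∀ j k : Fin n, ∑ q, christoffel S.φ m j q e.2.1
      * -∑ r, christoffel S.φ q k r e.2.1 * e.2.2 r μ
      = -∑ q, (∑ s, christoffel S.φ s q k e.2.1 * christoffel S.φ m s j e.2.1) * e.2.2 q μ := by
    intro j k
    simp only [mul_neg, Finset.sum_neg_distrib, Finset.mul_sum, Finset.sum_mul]
    rw [Finset.sum_comm]
    refine congrArg _ (Finset.sum_congr rfl fun q _ => Finset.sum_congr rfl fun r _ => ?_)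
    rw [christoffel_φ_symm he m j r, christoffel_φ_symm he r k q]
    ring
  have hs : ∀ i j k, partialDeriv (christoffel S.φ m i j) k e.2.1
      = partialDeriv (christoffel S.φ m j i) k e.2.1 := by
    -- The Christoffel symbol is symmetric only over `V`, so its derivatives are compared through
    -- equality near the point.
    intro i j k
    have : christoffel S.φ m i j =ᶠ[nhds e.2.1] christoffel S.φ m j i := by
      filter_upwards [S.isOpen_V.mem_nhds he.2] with x hx
      exact S.φ_metric.christoffel_symm S.isOpen_V hx m i j
    rw [partialDeriv, partialDeriv, this.fderiv_eq]
  simp only [coframe_V_lieBracket he, D_frame_M_vert he]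
  simp only [frame_M_vert,
    S.D_M_comp_snd_fst (differentiableAt_christoffel_φ he _ _ _), Finset.sum_add_distrib, h,
    metricCurvature, hs j, hs k]
  rw [← Finset.sum_neg_distrib, ← Finset.sum_neg_distrib, ← Finset.sum_add_distrib,
    ← Finset.sum_add_distrib, ← Finset.sum_neg_distrib, ← Finset.sum_neg_distrib,
    ← Finset.sum_sub_distrib, ← Finset.sum_neg_distrib]
  exact Finset.sum_congr rfl fun ε _ => by ring

/-- Since `h` depends only on `t` and `φ` only on `x`, no derivative of a Christoffel symbol
survives. The two remaining double sums of products `H γ x` coincide. -/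
theorem coframe_lieBracket_TM (m : Fin n) (μ β : Fin p) (k : Fin n) :
    S.coframe (.V m μ) e (VectorField.lieBracket ℝ (S.frame (.M k)) (S.frame (.T β)) e) = 0 := by
  simp only [coframe_V_lieBracket he, D_frame_M_vert he, D_frame_T_vert he]
  simp only [frame_M_vert,
    frame_T_vert, S.D_T_comp_snd_fst (differentiableAt_christoffel_φ he _ _ _),
    S.D_M_comp_fst (differentiableAt_christoffel_h he _ _ _), mul_zero, add_zero, mul_neg,
    Finset.sum_neg_distrib, Finset.mul_sum]
  rw [Finset.sum_comm, sub_eq_zero]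
  exact congrArg _ (Finset.sum_congr rfl fun _ _ => Finset.sum_congr rfl fun _ _ => by ring)

theorem coframe_lieBracket_TV (m : Fin n) (μ β : Fin p) (k : Fin n) (γ : Fin p) :
    S.coframe (.V m μ) e (VectorField.lieBracket ℝ (S.frame (.V k γ)) (S.frame (.T β)) e)
      = kron m k * christoffel S.h γ μ β e.1 := by
  simp only [coframe_V_lieBracket he, D_frame_V_vert, D_frame_T_vert he]
  simp only [frame_V_vert,
    S.D_V_comp_fst (differentiableAt_christoffel_h he _ _ _), mul_zero, add_zero, sub_zero]
  simp only [mul_left_comm _ (kron m k), ← Finset.mul_sum, sum_mul_kron']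

theorem coframe_lieBracket_MV (m : Fin n) (μ : Fin p) (j k : Fin n) (γ : Fin p) :
    S.coframe (.V m μ) e (VectorField.lieBracket ℝ (S.frame (.V k γ)) (S.frame (.M j)) e)
      = -(kron μ γ * christoffel S.φ m j k e.2.1) := by
  simp only [coframe_V_lieBracket he, D_frame_V_vert, D_frame_M_vert he]
  simp only [frame_V_vert,
    S.D_V_comp_snd_fst (differentiableAt_christoffel_φ he _ _ _), mul_zero, add_zero, sub_zero]
  simp only [← mul_assoc, ← Finset.sum_mul, sum_mul_kron']
  ring

theorem coframe_lieBracket_VV (m : Fin n) (μ : Fin p) (j k : Fin n) (β γ : Fin p) :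
    S.coframe (.V m μ) e (VectorField.lieBracket ℝ (S.frame (.V k γ)) (S.frame (.V j β)) e)
      = 0 := by
  simp only [coframe_V_lieBracket he, D_frame_V_vert]
  rw [sub_zero]

/-- `X_C X_B σ` is the Hessian of `σ` on the two fields plus `dσ` of the derivative of `X_B` along
`X_C`. The Hessians cancel by symmetry, leaving `[X_C, X_B] σ`, and the bracket is vertical. -/
theorem D_comm_σ (b c : JetIdx p n) :
    S.D c (S.D b S.σ) e - S.D b (S.D c S.σ) e
      = ∑ m, ∑ μ, S.σV m μ e
        * S.coframe (.V m μ) e (VectorField.lieBracket ℝ (S.frame c) (S.frame b) e) := by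
  have hd : ∀ b c : JetIdx p n, S.D c (S.D b S.σ) e
      = fderiv ℝ (fderiv ℝ S.σ) e (S.frame c e) (S.frame b e)
        + fderiv ℝ S.σ e (fderiv ℝ (S.frame b) e (S.frame c e)) := by
    intro b c
    have h1 := (((contDiffAt_σ he).fderiv_right (m := ∞) (by simp)).differentiableAt
      (by simp)).hasFDerivAt
    have h2 := ((contDiffAt_frame he b).differentiableAt (by simp)).hasFDerivAt
    have h3 : HasFDerivAt (S.D b S.σ) _ e := h1.clm_apply h2
    rw [D, h3.fderiv]
    simp [add_comm]
  have hsymm := (contDiffAt_σ he).isSymmSndFDerivAt 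
    (by simpa using WithTop.coe_le_coe.2 (le_top (a := (2 : ℕ∞)))) (S.frame c e) (S.frame b e)
  rw [hd, hd, hsymm, add_sub_add_left_eq_sub, ← map_sub]
  have hL : VectorField.lieBracket ℝ (S.frame c) (S.frame b) e = ∑ m, ∑ μ,
      S.coframe (.V m μ) e (VectorField.lieBracket ℝ (S.frame c) (S.frame b) e)
        • S.frame (.V m μ) e := by
    simp only [coframe_V_lieBracket he]
    rw [lieBracket_frame he]
    refine Prod.ext ?_ (Prod.ext ?_ (funext fun m => funext fun μ => ?_))
    · simp [Prod.fst_sum, frame]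
    · simp [Prod.fst_sum, Prod.snd_sum, frame]
    · simp only [Prod.snd_sum, Finset.sum_apply, Prod.smul_snd, Pi.smul_apply, frame_V_vert,
        smul_eq_mul]
      simp only [mul_left_comm _ (kron m _), ← Finset.mul_sum, sum_mul_kron, sum_kron_mul]
  change fderiv ℝ S.σ e (VectorField.lieBracket ℝ (S.frame c) (S.frame b) e) = _
  conv_lhs => rw [hL]
  simp only [map_sum, map_smul, smul_eq_mul]
  exact Finset.sum_congr rfl fun m _ => Finset.sum_congr rfl fun μ _ => mul_comm _ _

end Bracket

end GRGML

namespace GRGML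

variable {p n : ℕ} (S : GRGML p n)

/-! ### Explicit coefficients of the Cartan connection -/

section Cartan

variable {S} {e : JetCoord p n} (he : e ∈ S.domain)
include he

theorem D_g (A : JetIdx p n) (i j : Fin n) :
    S.D A (fun e' => S.g e' i j) e = Real.exp (2 * S.σ e)
      * (2 * S.D A S.σ e * S.φ e.2.1 i j + S.D A (fun e' => S.φ e'.2.1 i j) e) := by
  have hσ : DifferentiableAt ℝ S.σ e := (contDiffAt_σ he).differentiableAt (by simp)
  have hexp : DifferentiableAt ℝ (fun e' => Real.exp (2 * S.σ e')) e :=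
    (hσ.const_mul 2).exp
  have hφ := (contDiffAt_φ he i j).differentiableAt (by simp)
  have h : S.D A (fun e' => Real.exp (2 * S.σ e')) e
      = Real.exp (2 * S.σ e) * (2 * S.D A S.σ e) := by
    rw [D, fderiv_exp (hσ.const_mul 2), fderiv_const_mul hσ]
    simp [D]
  change S.D A (fun e' => Real.exp (2 * S.σ e') * S.φ e'.2.1 i j) e = _
  rw [S.D_mul hexp hφ, h]
  ring

/-- Metric compatibility divided by the common factor `e^{2σ}`. It serves both the spatial and the
vertical directions, with `K` the matrix of `L` or of `C` in a fixed direction. -/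
theorem sum_φ_of_metric {K : Fin n → Fin n → ℝ} {A : JetIdx p n} {i j : Fin n}
    (h : S.D A (fun e' => S.g e' i j) e
      - ∑ m, S.g e m j * K m i - ∑ m, S.g e i m * K m j = 0) :
    ∑ m, S.φ e.2.1 j m * K m i + ∑ m, S.φ e.2.1 i m * K m j
      = 2 * S.D A S.σ e * S.φ e.2.1 i j + S.D A (fun e' => S.φ e'.2.1 i j) e := by
  have h1 : ∑ m, S.g e m j * K m i
      = Real.exp (2 * S.σ e) * ∑ m, S.φ e.2.1 j m * K m i := by
    rw [Finset.mul_sum]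
    refine Finset.sum_congr rfl fun m _ => ?_
    rw [g, Matrix.of_apply, (S.φ_metric.symm _ he.2).apply]
    ring
  have h2 : ∑ m, S.g e i m * K m j
      = Real.exp (2 * S.σ e) * ∑ m, S.φ e.2.1 i m * K m j := by
    rw [Finset.mul_sum]
    refine Finset.sum_congr rfl fun m _ => ?_
    rw [g, Matrix.of_apply]
    ring
  rw [D_g he, h1, h2] at h
  refine mul_left_cancel₀ (Real.exp_ne_zero (2 * S.σ e)) ?_
  linarith

theorem Lam_symm (k i j : Fin n) : S.Lam k i j e = S.Lam k j i e := by
  rw [Lam, Lam, (S.φ_metric.symm _ he.2).apply]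
  ring

theorem Cten_symm (i j k : Fin n) (γ : Fin p) : S.Cten i j k γ e = S.Cten i k j γ e := by
  rw [Cten, Cten, (S.φ_metric.symm _ he.2).apply]
  ring

variable {Γ : HNormalConnection p n} (hΓ : S.IsCartan Γ)
include hΓ

/-- Both sides are symmetric in `i`, `j` and preserve the same metric: `γ` yields `∂_k φ_{ij}` and
`Λ` yields `2 σ_k φ_{ij}`. Koszul uniqueness then identifies them. -/
theorem IsCartan.L_eq (k i j : Fin n) :
    Γ.L k i j e = christoffel S.φ k i j e.2.1 + S.Lam k i j e := by
  have hA := S.φ_metric.nondegenerate _ he.2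
  refine congrFun (congrFun (congrFun (eq_of_metric hA (L := fun k i j => Γ.L k i j e)
    (L' := fun k i j => christoffel S.φ k i j e.2.1 + S.Lam k i j e)
    (hΓ.symm_L e he) (fun k i j => ?_) fun i j k => ?_) k) i) j
  · rw [christoffel_φ_symm he, Lam_symm he]
  · have h1 := sum_φ_of_metric he (K := fun m i => Γ.L m i k e) (hΓ.metric_M e he i j k)
    have h2 := conformal_metric hA (S.φ_metric.symm _ he.2) (fun k => S.σM k e) i j k
    have h3 := S.φ_metric.christoffel_metric S.isOpen_V he.2 i j k
    rw [S.D_M_comp_snd_fst (F := fun x => S.φ x i j)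
      ((S.φ_metric.contDiffAt S.isOpen_V he.2 i j).differentiableAt (by simp)), ← h3] at h1
    simp only [mul_add, Finset.sum_add_distrib, Lam] at h1 h2 ⊢
    change _ = 2 * S.σM k e * _ + _ at h1
    linarith

theorem IsCartan.C_eq (i j k : Fin n) (γ : Fin p) :
    Γ.C i j k γ e = S.Cten i j k γ e := by
  have hA := S.φ_metric.nondegenerate _ he.2
  refine congrFun (congrFun (congrFun (eq_of_metric hA (L := fun i j k => Γ.C i j k γ e)
    (L' := fun i j k => S.Cten i j k γ e)
    (fun i j k => hΓ.symm_C e he i j k γ) (fun i j k => Cten_symm he i j k γ)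
    fun i j k => ?_) i) j) k
  have h1 := sum_φ_of_metric he (K := fun m i => Γ.C m i k γ e) (hΓ.metric_V e he i j k γ)
  have h2 := conformal_metric hA (S.φ_metric.symm _ he.2) (fun k => S.σV k γ e) i j k
  rw [S.D_V_comp_snd_fst (F := fun x => S.φ x i j)
    ((S.φ_metric.contDiffAt S.isOpen_V he.2 i j).differentiableAt (by simp))] at h1
  simp only [Cten]
  -- `Cten` lists its two Kronecker terms in the opposite order to `conformal_metric`.
  simp only [add_comm (S.σV _ γ e * kron _ k)] at h2
  change _ = 2 * S.σV k γ e * _ + _ at h1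
  rw [h1, h2]
  ring

/-- As `φ` is independent of `t`, the derivative of `g` along `δ/δt^γ` is `2 σ_γ g`; contraction
with `½ g⁻¹` leaves a multiple of the identity. -/
theorem IsCartan.G_eq (k j : Fin n) (γ : Fin p) :
    Γ.G k j γ e = S.σT γ e * kron k j := by
  have hA := S.φ_metric.nondegenerate _ he.2
  have hg : IsUnit (S.g e).det := by
    have : S.g e = Real.exp (2 * S.σ e) • S.φ e.2.1 := rfl
    rw [this, Matrix.det_smul]
    exact (((Real.exp_ne_zero _).isUnit).pow _).mul hA
  have hD : ∀ m, S.D (.T γ) (fun e' => S.g e' m j) e = 2 * S.σT γ e * S.g e m j := by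
    intro m
    rw [D_g he, S.D_T_comp_snd_fst (F := fun x => S.φ x m j)
      ((S.φ_metric.contDiffAt S.isOpen_V he.2 m j).differentiableAt (by simp)), g,
      Matrix.of_apply, σT]
    ring
  have hinv : ∑ m, (S.g e)⁻¹ k m * S.g e m j = kron k j := by
    have := congrFun (congrFun (Matrix.nonsing_inv_mul _ hg) k) j
    rwa [Matrix.mul_apply, Matrix.one_apply] at this
  simp only [hΓ.temporal e he, hD, mul_left_comm _ (2 * S.σT γ e), ← Finset.mul_sum, hinv]
  ring

end Cartan

/-! ### Block structure of the coefficients; temporal curvature and torsion -/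

section Coeff

variable (Γ : HNormalConnection p n)

theorem coeff_T_M (α : Fin p) (i : Fin n) (b : JetIdx p n) :
    S.coeff Γ (.T α) (.M i) b = fun _ => 0 := by cases b <;> rfl

theorem coeff_M_T (i : Fin n) (α : Fin p) (b : JetIdx p n) :
    S.coeff Γ (.M i) (.T α) b = fun _ => 0 := by cases b <;> rfl

theorem coeff_T_V (α : Fin p) (l : Fin n) (η : Fin p) (b : JetIdx p n) :
    S.coeff Γ (.T α) (.V l η) b = fun _ => 0 := by cases b <;> rfl

theorem coeff_V_T (l : Fin n) (η α : Fin p) (b : JetIdx p n) :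
    S.coeff Γ (.V l η) (.T α) b = fun _ => 0 := by cases b <;> rfl

theorem coeff_M_V (i l : Fin n) (η : Fin p) (b : JetIdx p n) :
    S.coeff Γ (.M i) (.V l η) b = fun _ => 0 := by cases b <;> rfl

theorem coeff_V_M (l : Fin n) (η : Fin p) (i : Fin n) (b : JetIdx p n) :
    S.coeff Γ (.V l η) (.M i) b = fun _ => 0 := by cases b <;> rfl

theorem coeff_T_T_M (α η : Fin p) (k : Fin n) :
    S.coeff Γ (.T α) (.T η) (.M k) = fun _ => 0 := rfl

theorem coeff_T_T_V (α η : Fin p) (k : Fin n) (γ : Fin p) :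
    S.coeff Γ (.T α) (.T η) (.V k γ) = fun _ => 0 := rfl

theorem coeff_T_T_T (α η γ : Fin p) :
    S.coeff Γ (.T α) (.T η) (.T γ) = fun e => christoffel S.h α η γ e.1 := rfl

/-- The Leibniz rule for a spatial vector tensored with a temporal covector; the minus sign comes
from the dual connection. -/
theorem coeff_V_V (l : Fin n) (η : Fin p) (i : Fin n) (α : Fin p) (b : JetIdx p n)
    (e : JetCoord p n) :
    S.coeff Γ (.V l η) (.V i α) b e
      = kron α η * S.coeff Γ (.M l) (.M i) b e - kron l i * S.coeff Γ (.T α) (.T η) b e := by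
  cases b <;> simp [coeff]

theorem curvComp_eq_zero_T_M (α : Fin p) (i : Fin n) (b c : JetIdx p n) (e : JetCoord p n) :
    S.curvComp Γ (.T α) (.M i) b c e = 0 ∧ S.curvComp Γ (.M i) (.T α) b c e = 0 := by
  constructor <;> simp [curvComp_eq, JetIdx.sum_eq, coeff_T_M, coeff_M_T, coeff_T_V, coeff_V_T,
    coeff_M_V, coeff_V_M, D_const]

theorem curvComp_eq_zero_T_V (α : Fin p) (l : Fin n) (η : Fin p) (b c : JetIdx p n)
    (e : JetCoord p n) :
    S.curvComp Γ (.T α) (.V l η) b c e = 0 ∧ S.curvComp Γ (.V l η) (.T α) b c e = 0 := by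
  constructor <;> simp [curvComp_eq, JetIdx.sum_eq, coeff_T_M, coeff_M_T, coeff_T_V, coeff_V_T,
    coeff_M_V, coeff_V_M, D_const]

theorem curvComp_eq_zero_M_V (i l : Fin n) (η : Fin p) (b c : JetIdx p n) (e : JetCoord p n) :
    S.curvComp Γ (.M i) (.V l η) b c e = 0 ∧ S.curvComp Γ (.V l η) (.M i) b c e = 0 := by
  constructor <;> simp [curvComp_eq, JetIdx.sum_eq, coeff_T_M, coeff_M_T, coeff_T_V, coeff_V_T,
    coeff_M_V, coeff_V_M, D_const]

variable {S} {e : JetCoord p n} (he : e ∈ S.domain)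
include he

/-- The bracket term drops out: brackets are vertical, and temporal fields are parallel in vertical
directions. -/
theorem curvComp_T_T (α η : Fin p) (b c : JetIdx p n) :
    S.curvComp Γ (.T α) (.T η) b c e
      = S.D c (S.coeff Γ (.T α) (.T η) b) e - S.D b (S.coeff Γ (.T α) (.T η) c) e
        + ∑ ν, S.coeff Γ (.T ν) (.T η) b e * S.coeff Γ (.T α) (.T ν) c e
        - ∑ ν, S.coeff Γ (.T ν) (.T η) c e * S.coeff Γ (.T α) (.T ν) b e := by
  rw [curvComp_eq, sum_lieBracket he, JetIdx.sum_eq, JetIdx.sum_eq]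
  simp [coeff_T_T_V, coeff_M_T, coeff_V_T]

theorem curvComp_M_M (l i : Fin n) (b c : JetIdx p n) :
    S.curvComp Γ (.M l) (.M i) b c e
      = S.D c (S.coeff Γ (.M l) (.M i) b) e - S.D b (S.coeff Γ (.M l) (.M i) c) e
        + ∑ m, S.coeff Γ (.M m) (.M i) b e * S.coeff Γ (.M l) (.M m) c e
        - ∑ m, S.coeff Γ (.M m) (.M i) c e * S.coeff Γ (.M l) (.M m) b e
        - ∑ m, ∑ μ, Γ.C l i m μ e
          * S.coframe (.V m μ) e (VectorField.lieBracket ℝ (S.frame c) (S.frame b) e) := by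
  rw [curvComp_eq, sum_lieBracket he, JetIdx.sum_eq, JetIdx.sum_eq]
  simp [coeff_T_M, coeff_V_M]
  rfl

theorem curvComp_T_T_T_T (α η β γ : Fin p) :
    S.curvComp Γ (.T α) (.T η) (.T β) (.T γ) e = metricCurvature S.h α η β γ e.1 := by
  rw [curvComp_T_T Γ he]
  simp only [coeff_T_T_T, S.D_T_comp_fst (differentiableAt_christoffel_h he _ _ _)]
  rfl

theorem curvComp_T_T_M (α η : Fin p) (b : JetIdx p n) (k : Fin n) :
    S.curvComp Γ (.T α) (.T η) b (.M k) e = 0 := by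
  rw [curvComp_T_T Γ he]
  cases b <;> simp [coeff_T_T_M, coeff_T_T_V, coeff_T_T_T, D_const,
    S.D_M_comp_fst (differentiableAt_christoffel_h he _ _ _)]

theorem curvComp_T_T_V (α η : Fin p) (b : JetIdx p n) (k : Fin n) (γ : Fin p) :
    S.curvComp Γ (.T α) (.T η) b (.V k γ) e = 0 := by
  rw [curvComp_T_T Γ he]
  cases b <;> simp [coeff_T_T_M, coeff_T_T_V, coeff_T_T_T, D_const,
    S.D_V_comp_fst (differentiableAt_christoffel_h he _ _ _)]

theorem differentiableAt_coeff_T_T (α η : Fin p) (b : JetIdx p n) :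
    DifferentiableAt ℝ (S.coeff Γ (.T α) (.T η) b) e := by
  cases b with
  | T β => exact (contDiffAt_christoffel_h he α η β).differentiableAt (by simp)
  | M j => exact differentiableAt_const _
  | V j γ => exact differentiableAt_const _

theorem torsionComp_T_T (m : Fin n) (μ β γ : Fin p) :
    S.torsionComp Γ (.V m μ) (.T β) (.T γ) e
      = -∑ ε, metricCurvature S.h ε μ β γ e.1 * e.2.2 m ε := by
  rw [torsionComp_eq, coframe_lieBracket_TT he, coeff_V_T, coeff_V_T]
  ring

theorem torsionComp_M_M (m : Fin n) (μ : Fin p) (j k : Fin n) :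
    S.torsionComp Γ (.V m μ) (.M j) (.M k) e
      = ∑ q, metricCurvature S.φ m q j k e.2.1 * e.2.2 q μ := by
  rw [torsionComp_eq, coframe_lieBracket_MM he, coeff_V_M, coeff_V_M]
  ring

end Coeff

/-! ### Vertical curvature and the component `R^l_{iβγ}` -/

section Curvature

variable {S} {Γ : HNormalConnection p n} (hΓ : S.IsCartan Γ) {e : JetCoord p n}
  (he : e ∈ S.domain)
include hΓ he

/-- Smoothness is not part of the data of `Γ`; it is inherited from the explicit formulas, valid
near `e`. -/
theorem IsCartan.differentiableAt_coeff_M_M (l i : Fin n) (b : JetIdx p n) :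
    DifferentiableAt ℝ (S.coeff Γ (.M l) (.M i) b) e := by
  have hn := S.isOpen_domain.mem_nhds he
  cases b with
  | T β =>
    refine (((contDiffAt_D_σ he (.T β)).differentiableAt (by simp)).mul_const
      (kron l i)).congr_of_eventuallyEq ?_
    filter_upwards [hn] with e' he' using hΓ.G_eq he' l i β
  | M j =>
    refine (((contDiffAt_christoffel_φ he l i j).differentiableAt (by simp)).add
      ((contDiffAt_Lam he l i j).differentiableAt (by simp))).congr_of_eventuallyEq ?_
    filter_upwards [hn] with e' he' using hΓ.L_eq he' l i j
  | V j γ =>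
    refine ((contDiffAt_Cten he l i j γ).differentiableAt (by simp)).congr_of_eventuallyEq ?_
    filter_upwards [hn] with e' he' using hΓ.C_eq he' l i j γ

theorem IsCartan.D_coeff_T (A : JetIdx p n) (l i : Fin n) (β : Fin p) :
    S.D A (S.coeff Γ (.M l) (.M i) (.T β)) e = S.D A (S.σT β) e * kron l i := by
  refine (S.D_congr he fun e' he' => hΓ.G_eq he' l i β).trans ?_
  exact S.D_mul_const ((contDiffAt_D_σ he (.T β)).differentiableAt (by simp)) _

theorem IsCartan.D_coeff_M (A : JetIdx p n) (l i j : Fin n) :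
    S.D A (S.coeff Γ (.M l) (.M i) (.M j)) e
      = S.D A (fun e' => christoffel S.φ l i j e'.2.1) e + S.D A (S.Lam l i j) e := by
  refine (S.D_congr he fun e' he' => hΓ.L_eq he' l i j).trans ?_
  exact S.D_add ((contDiffAt_christoffel_φ he l i j).differentiableAt (by simp))
    ((contDiffAt_Lam he l i j).differentiableAt (by simp))

theorem IsCartan.D_coeff_V (A : JetIdx p n) (l i j : Fin n) (γ : Fin p) :
    S.D A (S.coeff Γ (.M l) (.M i) (.V j γ)) e = S.D A (S.Cten l i j γ) e :=
  S.D_congr he fun _ he' => hΓ.C_eq he' l i j γ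

theorem IsCartan.coeff_T (l i : Fin n) (β : Fin p) :
    S.coeff Γ (.M l) (.M i) (.T β) e = S.σT β e * kron l i :=
  hΓ.G_eq he l i β

theorem IsCartan.coeff_M (l i j : Fin n) :
    S.coeff Γ (.M l) (.M i) (.M j) e = christoffel S.φ l i j e.2.1 + S.Lam l i j e :=
  hΓ.L_eq he l i j

theorem IsCartan.coeff_V (l i j : Fin n) (γ : Fin p) :
    S.coeff Γ (.M l) (.M i) (.V j γ) e = S.Cten l i j γ e :=
  hΓ.C_eq he l i j γ

theorem IsCartan.curvComp_V_V (l : Fin n) (η : Fin p) (i : Fin n) (α : Fin p)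
    (b c : JetIdx p n) :
    S.curvComp Γ (.V l η) (.V i α) b c e = kron α η * S.curvComp Γ (.M l) (.M i) b c e
      - kron l i * S.curvComp Γ (.T α) (.T η) b c e := by
  have hD : ∀ A b, S.D A (S.coeff Γ (.V l η) (.V i α) b) e
      = kron α η * S.D A (S.coeff Γ (.M l) (.M i) b) e
        - kron l i * S.D A (S.coeff Γ (.T α) (.T η) b) e := by
    intro A b
    have hM := hΓ.differentiableAt_coeff_M_M he l i b
    have hT := differentiableAt_coeff_T_T Γ he α η b
    rw [S.D_congr he fun e' _ => S.coeff_V_V Γ l η i α b e', S.D_sub (hM.const_mul _)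
      (hT.const_mul _), S.D_const_mul hM, S.D_const_mul hT]
  -- The mixed spatial-temporal products are symmetric in `b`, `c` and vanish after
  -- antisymmetrization. The purely temporal product appears with `b`, `c` exchanged, which gives
  -- the minus sign of the dual curvature.
  have hsum : ∀ b c, ∑ f, S.coeff Γ f (.V i α) b e * S.coeff Γ (.V l η) f c e
      = kron α η * ∑ m, S.coeff Γ (.M m) (.M i) b e * S.coeff Γ (.M l) (.M m) c e
        - S.coeff Γ (.M l) (.M i) b e * S.coeff Γ (.T α) (.T η) c e
        - S.coeff Γ (.M l) (.M i) c e * S.coeff Γ (.T α) (.T η) b e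
        + kron l i * ∑ ν, S.coeff Γ (.T ν) (.T η) c e * S.coeff Γ (.T α) (.T ν) b e := by
    intro b c
    have h : ∀ m ν, S.coeff Γ (.V m ν) (.V i α) b e * S.coeff Γ (.V l η) (.V m ν) c e
        = kron α ν * (kron ν η * (S.coeff Γ (.M m) (.M i) b e * S.coeff Γ (.M l) (.M m) c e))
          - kron α ν * (kron l m * (S.coeff Γ (.M m) (.M i) b e * S.coeff Γ (.T ν) (.T η) c e))
          - kron ν η * (kron m i * (S.coeff Γ (.M l) (.M m) c e * S.coeff Γ (.T α) (.T ν) b e))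
          + kron l m * (kron m i
            * (S.coeff Γ (.T ν) (.T η) c e * S.coeff Γ (.T α) (.T ν) b e)) := by
      intro m ν
      rw [coeff_V_V, coeff_V_V]
      ring
    rw [JetIdx.sum_eq]
    simp only [coeff_T_V, coeff_M_V, zero_mul, Finset.sum_const_zero, zero_add, h,
      Finset.sum_add_distrib, Finset.sum_sub_distrib, sum_kron_mul, sum_kron_mul',
      ← Finset.mul_sum]
  have hlie : ∑ f, S.coeff Γ (.V l η) (.V i α) f e
        * S.coframe f e (VectorField.lieBracket ℝ (S.frame c) (S.frame b) e)
      = kron α η * ∑ m, ∑ μ, Γ.C l i m μ e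
        * S.coframe (.V m μ) e (VectorField.lieBracket ℝ (S.frame c) (S.frame b) e) := by
    rw [sum_lieBracket he]
    simp only [Finset.mul_sum, ← mul_assoc]
    rfl
  rw [curvComp_eq, hsum, hsum, hlie, hD, hD, curvComp_M_M Γ he, curvComp_T_T Γ he]
  ring

/-- The matrices `G` are scalar, so their commutator vanishes. What remains is `[δ/δt^γ, δ/δt^β] σ`
times the identity minus `C` on the bracket, and the torsion is minus that bracket. -/
theorem IsCartan.curvComp_M_M_T_T (l i : Fin n) (β γ : Fin p) :
    S.curvComp Γ (.M l) (.M i) (.T β) (.T γ) e =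
      ∑ m, ∑ μ, (S.Cten l i m μ e - kron l i * S.σV m μ e)
        * S.torsionComp Γ (.V m μ) (.T β) (.T γ) e := by
  have hcomm := D_comm_σ he (.T β) (.T γ)
  change S.D _ (S.σT β) e - S.D _ (S.σT γ) e = _ at hcomm
  have ht : ∀ m μ, S.torsionComp Γ (.V m μ) (.T β) (.T γ) e = -S.coframe (.V m μ) e
      (VectorField.lieBracket ℝ (S.frame (.T γ)) (S.frame (.T β)) e) := by
    intro m μ
    rw [torsionComp_eq, coeff_V_T, coeff_V_T]
    ring
  rw [curvComp_M_M Γ he, hΓ.D_coeff_T he, hΓ.D_coeff_T he, ← sub_mul, hcomm]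
  simp only [hΓ.coeff_T he, hΓ.C_eq he, ht, sub_mul, Finset.sum_sub_distrib, mul_neg,
    Finset.sum_neg_distrib, mul_assoc (kron l i), ← Finset.mul_sum]
  have : ∀ β γ, ∑ m, S.σT β e * kron m i * (S.σT γ e * kron l m)
      = S.σT β e * S.σT γ e * kron l i := by
    intro β γ
    rw [← sum_mul_kron l fun m => S.σT β e * S.σT γ e * kron m i]
    exact Finset.sum_congr rfl fun _ _ => by ring
  rw [this, this]
  ring

end Curvature

end GRGML

/-! ### The remaining five curvature components -/

namespace GRGML

variable {p n : ℕ}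

theorem D_T_Lam {S : GRGML p n} {e : JetCoord p n} (he : e ∈ S.domain) (β : Fin p) (l i k : Fin n) :
    S.D (.T β) (S.Lam l i k) e = S.D (.T β) (S.σM i) e * kron l k
      + S.D (.T β) (S.σM k) e * kron l i
      - S.φ e.2.1 i k * ∑ m, (S.φ e.2.1)⁻¹ l m * S.D (.T β) (S.σM m) e := by
  have hσ : ∀ m, DifferentiableAt ℝ (S.σM m) e := fun m =>
    (contDiffAt_D_σ he (.M m)).differentiableAt (by simp)
  have hinv : ∀ m, DifferentiableAt ℝ (fun e' => (S.φ e'.2.1)⁻¹ l m) e := fun m =>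
    (contDiffAt_φ_inv he l m).differentiableAt (by simp)
  have hφ : DifferentiableAt ℝ (fun e' => S.φ e'.2.1 i k) e :=
    (contDiffAt_φ he i k).differentiableAt (by simp)
  have hsum : DifferentiableAt ℝ (fun e' => ∑ m, (S.φ e'.2.1)⁻¹ l m * S.σM m e') e :=
    DifferentiableAt.fun_sum fun m _ => (hinv m).mul (hσ m)
  change S.D (.T β) (fun e' => S.σM i e' * kron l k + S.σM k e' * kron l i
    - S.φ e'.2.1 i k * ∑ m, (S.φ e'.2.1)⁻¹ l m * S.σM m e') e = _
  rw [S.D_sub (f := fun e' => S.σM i e' * kron l k + S.σM k e' * kron l i)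
      (f' := fun e' => S.φ e'.2.1 i k * ∑ m, (S.φ e'.2.1)⁻¹ l m * S.σM m e')
      (((hσ i).mul_const _).add ((hσ k).mul_const _)) (hφ.mul hsum),
    S.D_add (f := fun e' => S.σM i e' * kron l k) (f' := fun e' => S.σM k e' * kron l i)
      ((hσ i).mul_const _) ((hσ k).mul_const _), S.D_mul_const (hσ i),
    S.D_mul_const (hσ k), S.D_mul hφ hsum,
    S.D_sum (f := fun m e' => (S.φ e'.2.1)⁻¹ l m * S.σM m e') fun m => (hinv m).mul (hσ m),
    S.D_T_comp_snd_fst (F := fun x => S.φ x i k)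
      ((S.φ_metric.contDiffAt S.isOpen_V he.2 i k).differentiableAt (by simp))]
  have : ∀ m, S.D (.T β) (fun e' => (S.φ e'.2.1)⁻¹ l m * S.σM m e') e
      = (S.φ e.2.1)⁻¹ l m * S.D (.T β) (S.σM m) e := by
    intro m
    rw [S.D_mul (hinv m) (hσ m), S.D_T_comp_snd_fst (F := fun x => (S.φ x)⁻¹ l m)
      ((S.φ_metric.contDiffAt_inv S.isOpen_V he.2 l m).differentiableAt (by simp))]
    ring
  simp only [this]
  ring

variable {S : GRGML p n} {Γ : HNormalConnection p n} (hΓ : S.IsCartan Γ)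
  {e : JetCoord p n} (he : e ∈ S.domain)
include hΓ he

theorem IsCartan.sum_coeff_T_comm (l i : Fin n) (β : Fin p) (c : JetIdx p n) :
    ∑ m, S.coeff Γ (.M m) (.M i) (.T β) e * S.coeff Γ (.M l) (.M m) c e
      = ∑ m, S.coeff Γ (.M m) (.M i) c e * S.coeff Γ (.M l) (.M m) (.T β) e := by
  simp only [hΓ.coeff_T he, mul_assoc, mul_left_comm _ (S.σT β e), ← Finset.mul_sum,
    sum_kron_mul', sum_mul_kron]

/-- The mixed bracket is zero, so `δσ_β/δx^k = δσ_k/δt^β`. This cancels the `σ_k δ^l_i` term of the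
derivative of `Λ`. -/
theorem IsCartan.curvComp_M_M_T_M (l i : Fin n) (β : Fin p) (k : Fin n) :
    S.curvComp Γ (.M l) (.M i) (.T β) (.M k) e =
      ∑ m, (S.φ e.2.1 i k * (S.φ e.2.1)⁻¹ l m - kron l k * kron m i)
        * S.covT1 S.berwald S.σM m β e := by
  have hcov : ∀ m, S.covT1 S.berwald S.σM m β e = S.D (.T β) (S.σM m) e := fun m => by
    simp [covT1, berwald]
  have hcomm := D_comm_σ he (.T β) (.M k)
  simp only [coframe_lieBracket_TM he, mul_zero, Finset.sum_const_zero] at hcomm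
  change S.D _ (S.σT β) e - S.D _ (S.σM k) e = 0 at hcomm
  rw [curvComp_M_M Γ he, hΓ.sum_coeff_T_comm he, hΓ.D_coeff_T he, hΓ.D_coeff_M he,
    D_T_Lam he, S.D_T_comp_snd_fst (differentiableAt_christoffel_φ he _ _ _),
    sub_eq_zero.1 hcomm]
  simp only [coframe_lieBracket_TM he, hcov, sub_mul, Finset.sum_sub_distrib, mul_assoc,
    ← Finset.mul_sum, sum_kron_mul', mul_zero, Finset.sum_const_zero]
  ring

theorem IsCartan.curvComp_M_M_M_M (l i j k : Fin n) :
    S.curvComp Γ (.M l) (.M i) (.M j) (.M k) e =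
      metricCurvature S.φ l i j k e.2.1
        + S.covM3 S.berwald S.Lam l i j k e - S.covM3 S.berwald S.Lam l i k j e
        + ∑ m, S.Lam m i j e * S.Lam l m k e - ∑ m, S.Lam m i k e * S.Lam l m j e
        + ∑ m, ∑ μ, S.Cten l i m μ e * S.torsionComp Γ (.V m μ) (.M j) (.M k) e := by
  have ht : ∀ m μ, S.torsionComp Γ (.V m μ) (.M j) (.M k) e = -S.coframe (.V m μ) e
      (VectorField.lieBracket ℝ (S.frame (.M k)) (S.frame (.M j)) e) := by
    intro m μ
    rw [torsionComp_eq, coeff_V_M, coeff_V_M]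
    ring
  rw [curvComp_M_M Γ he, hΓ.D_coeff_M he, hΓ.D_coeff_M he,
    S.D_M_comp_snd_fst (differentiableAt_christoffel_φ he _ _ _),
    S.D_M_comp_snd_fst (differentiableAt_christoffel_φ he _ _ _)]
  -- Expanding `(γ + Λ)(γ + Λ)`: the `γγ` terms complete `r`, the cross terms complete the Berwald
  -- derivatives. The terms `Λ^l_{im} γ^m_{jk}` of the two derivatives cancel by symmetry of `γ`.
  simp only [hΓ.coeff_M he, hΓ.C_eq he, ht, covM3, berwald, metricCurvature, add_mul, mul_add,
    Finset.sum_add_distrib, mul_neg, Finset.sum_neg_distrib, christoffel_φ_symm he _ k j,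
    mul_comm (christoffel S.φ _ _ _ _) (S.Lam _ _ _ _)]
  ring

/-- `G` commutes with `C`; the final term is `C` evaluated on the bracket, whose components are
Christoffel symbols of `h`. -/
theorem IsCartan.curvComp_M_M_T_V (l i : Fin n) (β : Fin p) (k : Fin n) (γ : Fin p) :
    S.curvComp Γ (.M l) (.M i) (.T β) (.V k γ) e =
      S.D (.V k γ) (S.σT β) e * kron l i - S.D (.T β) (S.Cten l i k γ) e
        - ∑ μ, S.Cten l i k μ e * christoffel S.h γ μ β e.1 := by
  rw [curvComp_M_M Γ he, hΓ.sum_coeff_T_comm he, hΓ.D_coeff_T he, hΓ.D_coeff_V he,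
    Finset.sum_comm]
  simp only [coframe_lieBracket_TV he, hΓ.C_eq he, mul_left_comm _ (kron _ k), sum_kron_mul']
  ring

/-- The commutator with `γ` supplies two of the three connection terms of the Berwald derivative of
`C`. The third, acting on the index `k`, comes from the bracket. -/
theorem IsCartan.curvComp_M_M_M_V (l i j k : Fin n) (γ : Fin p) :
    S.curvComp Γ (.M l) (.M i) (.M j) (.V k γ) e =
      S.covV3 S.berwald S.Lam l i j k γ e - S.covM4 S.berwald S.Cten l i k γ j e
        - ∑ m, S.Lam l j m e * S.Cten m i k γ e + ∑ m, S.Lam m i j e * S.Cten l m k γ e := by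
  rw [curvComp_M_M Γ he, hΓ.D_coeff_M he, hΓ.D_coeff_V he,
    S.D_V_comp_snd_fst (differentiableAt_christoffel_φ he _ _ _)]
  simp only [coframe_lieBracket_MV he, hΓ.C_eq he, hΓ.coeff_M he, hΓ.coeff_V he, covV3, covM4,
    berwald, mul_neg, Finset.sum_neg_distrib, mul_left_comm _ (kron _ γ), sum_kron_mul',
    add_mul, mul_add, Finset.sum_add_distrib, zero_mul,
    Finset.sum_const_zero, christoffel_φ_symm he _ k j, Lam_symm he l j, mul_comm (christoffel S.φ _ _ _ _),
    mul_comm (S.Lam _ _ _ _)]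
  ring

theorem IsCartan.curvComp_M_M_V_V (l i j : Fin n) (β : Fin p) (k : Fin n) (γ : Fin p) :
    S.curvComp Γ (.M l) (.M i) (.V j β) (.V k γ) e =
      S.covV4 S.berwald S.Cten l i j β k γ e - S.covV4 S.berwald S.Cten l i k γ j β e
        + ∑ m, S.Cten m i j β e * S.Cten l m k γ e
        - ∑ m, S.Cten m i k γ e * S.Cten l m j β e := by
  rw [curvComp_M_M Γ he, hΓ.D_coeff_V he, hΓ.D_coeff_V he]
  simp [coframe_lieBracket_VV he, hΓ.coeff_V he, covV4, berwald]

end GRGML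
theorem mainTheorem3 {p n : ℕ} (S : GRGML p n) (Γ : HNormalConnection p n)
    (hΓ : S.IsCartan Γ) (e : JetCoord p n) (he : e ∈ S.domain) :
    -- all adapted components of the curvature are determined by the seven below
    (∀ d a b c, S.curvComp Γ d a b c e = - S.curvComp Γ d a c b e) ∧
    (∀ α i b c, S.curvComp Γ (.T α) (.M i) b c e = 0 ∧ S.curvComp Γ (.M i) (.T α) b c e = 0) ∧
    (∀ α l η b c, S.curvComp Γ (.T α) (.V l η) b c e = 0 ∧
      S.curvComp Γ (.V l η) (.T α) b c e = 0) ∧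
    (∀ i l η b c, S.curvComp Γ (.M i) (.V l η) b c e = 0 ∧
      S.curvComp Γ (.V l η) (.M i) b c e = 0) ∧
    (∀ α η b k, S.curvComp Γ (.T α) (.T η) b (.M k) e = 0) ∧
    (∀ α η b k γ, S.curvComp Γ (.T α) (.T η) b (.V k γ) e = 0) ∧
    (∀ l η i α b c, S.curvComp Γ (.V l η) (.V i α) b c e =
      kron α η * S.curvComp Γ (.M l) (.M i) b c e
        - kron l i * S.curvComp Γ (.T α) (.T η) b c e) ∧
    -- the torsion components `R^{(m)}_{(μ)βγ}` and `R^{(m)}_{(μ)jk}`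
    (∀ m μ β γ, S.torsionComp Γ (.V m μ) (.T β) (.T γ) e =
      - ∑ ε, metricCurvature S.h ε μ β γ e.1 * e.2.2 m ε) ∧
    (∀ m μ j k, S.torsionComp Γ (.V m μ) (.M j) (.M k) e =
      ∑ q, metricCurvature S.φ m q j k e.2.1 * e.2.2 q μ) ∧
    -- `H^α_{ηβγ}`
    (∀ α η β γ, S.curvComp Γ (.T α) (.T η) (.T β) (.T γ) e =
      metricCurvature S.h α η β γ e.1) ∧
    -- `R^l_{iβγ}`
    (∀ l i β γ, S.curvComp Γ (.M l) (.M i) (.T β) (.T γ) e =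
      ∑ m, ∑ μ, (S.Cten l i m μ e - kron l i * S.σV m μ e)
        * S.torsionComp Γ (.V m μ) (.T β) (.T γ) e) ∧
    -- `R^l_{iβk}`
    (∀ l i β k, S.curvComp Γ (.M l) (.M i) (.T β) (.M k) e =
      ∑ m, (S.φ e.2.1 i k * (S.φ e.2.1)⁻¹ l m - kron l k * kron m i)
        * S.covT1 S.berwald S.σM m β e) ∧
    -- `R^l_{ijk}`
    (∀ l i j k, S.curvComp Γ (.M l) (.M i) (.M j) (.M k) e =
      metricCurvature S.φ l i j k e.2.1
        + S.covM3 S.berwald S.Lam l i j k e - S.covM3 S.berwald S.Lam l i k j e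
        + ∑ m, S.Lam m i j e * S.Lam l m k e - ∑ m, S.Lam m i k e * S.Lam l m j e
        + ∑ m, ∑ μ, S.Cten l i m μ e * S.torsionComp Γ (.V m μ) (.M j) (.M k) e) ∧
    -- `P^{l (γ)}_{iβ(k)}`
    (∀ l i β k γ, S.curvComp Γ (.M l) (.M i) (.T β) (.V k γ) e =
      S.D (.V k γ) (S.σT β) e * kron l i - S.D (.T β) (S.Cten l i k γ) e
        - ∑ μ, S.Cten l i k μ e * christoffel S.h γ μ β e.1) ∧
    -- `P^{l (γ)}_{ij(k)}`
    (∀ l i j k γ, S.curvComp Γ (.M l) (.M i) (.M j) (.V k γ) e =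
      S.covV3 S.berwald S.Lam l i j k γ e - S.covM4 S.berwald S.Cten l i k γ j e
        - ∑ m, S.Lam l j m e * S.Cten m i k γ e + ∑ m, S.Lam m i j e * S.Cten l m k γ e) ∧
    -- `S^{l(β)(γ)}_{i(j)(k)}`
    (∀ l i j β k γ, S.curvComp Γ (.M l) (.M i) (.V j β) (.V k γ) e =
      S.covV4 S.berwald S.Cten l i j β k γ e - S.covV4 S.berwald S.Cten l i k γ j β e
        + ∑ m, S.Cten m i j β e * S.Cten l m k γ e
        - ∑ m, S.Cten m i k γ e * S.Cten l m j β e) :=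
  ⟨fun d a b c => S.curvComp_swap Γ d a b c e,
    fun α i b c => S.curvComp_eq_zero_T_M Γ α i b c e,
    fun α l η b c => S.curvComp_eq_zero_T_V Γ α l η b c e,
    fun i l η b c => S.curvComp_eq_zero_M_V Γ i l η b c e,
    GRGML.curvComp_T_T_M Γ he, GRGML.curvComp_T_T_V Γ he, hΓ.curvComp_V_V he,
    GRGML.torsionComp_T_T Γ he, GRGML.torsionComp_M_M Γ he, GRGML.curvComp_T_T_T_T Γ he,
    hΓ.curvComp_M_M_T_T he, hΓ.curvComp_M_M_T_M he, hΓ.curvComp_M_M_M_M he,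
    hΓ.curvComp_M_M_T_V he, hΓ.curvComp_M_M_M_V he, hΓ.curvComp_M_M_V_V he⟩
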